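/- Let $R\ge 1$ be an integer and $\eta\in[0,1]$. Let $(U_m)_{m\ge0}$ and $(\theta_m)_{m\ge1}$ be the states and inter-transmission times of the Markov renewal process on $\{1,\dots,R\}$ with $U_0=1$ such that, given $U_0,\dots,U_m,\theta_1,\dots,\theta_m$ with $U_m=i$, the variables $U_{m+1}$ and $\theta_{m+1}$ are independent, $U_{m+1}$ equals $j$ with probability $p_{ij}=1/i$ if $R-i<j\le R$ and $p_{ij}=0$ otherwise, and $\theta_{m+1}$ is distributed as $\nu_i:=\eta+(1-\eta)X_i$, where $X_i$ has the Beta$(1,i)$ distribution. Put $T_m=\sum_{i=1}^m\theta_i$, $H^{(n)}=\min\{m:\sum_{i=1}^mU_i\ge n\}$, $T^{(n)}=T_{H^{(n)}}$ (the end-to-end delay), and $B(t)=\sum_{i=1}^mU_i$ for $t\in[T_m,T_{m+1})$. For $i,j\in\{1,\dots,R\}$, let $\eta_{i,j}\ge1$ be the number of transitions of $(U_m)$ between first entering state $i$ (at index $0$ if $i=1$) and next entering state $j$, let $T_{\eta_{i,j}}$ denote the time elapsed and $B(T_{\eta_{i,j}})$ the number of nodes updated (the increment of $B$) during these transitions,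 and write $G_{i,j}[z,s]=\mathbb E\big[z^{B(T_{\eta_{i,j}})}e^{sT_{\eta_{i,j}}}\big]$. Let $M_Y(s)=\mathbb E[e^{sY}]$ for a real random variable $Y$. Then for every $s\in\mathbb C$: (a) $M_{T^{(n)}}(s)$ (for all $n\ge0$) and $M_{\nu_j}(s)$ (for $1\le j\le R$) are expectations of integrable variables. (b) The series $\sum_n M_{T^{(n)}}(\operatorname{Re}s)\,|z|^n$ converges for every $z\in\mathbb C$ with $|z|<1$ and $|z|e^{\operatorname{Re}s}<1$. (c) For every $z\in\mathbb C$, $z\ne1$, for which the series in (b) converges, the expectations defining $G_{1,j}[z,s]$ and $G_{j,j}[z,s]$ converge absolutely and $G_{j,j}[z,s]\neq1$ for all $1\le j\le R$, and $$\mathcal T[z,s]:=\sum_{n=0}^\infty M_{T^{(n)}}(s)\,z^n=\frac{z}{z-1}\left(1-M_{\nu_1}(s)+\sum_{j=1}^R\big(1-M_{\nu_j}(s)\big)\frac{G_{1,j}[z,s]}{1-G_{j,j}[z,s]}\right)+\frac1{1-z}.$$ (d) For every $n\ge0$, $M_{T^{(n)}}(s)=\dfrac1{n!}\,\dfrac{\mathrm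 d^n}{\mathrm dz^n}\mathcal T[z,s]\Big|_{z=0}$. -/

import Mathlib

open MeasureTheory ProbabilityTheory
open scoped ENNReal

noncomputable section

namespace Trickle

/-- The transition probability `p i j` of the chain counting the newly updated nodes:
`1 / i` if `R - i < j ≤ R`, and `0` otherwise. -/
def stepProb (R i j : ℕ) : ℝ≥0∞ :=
  if R < i + j ∧ j ≤ R then (i : ℝ≥0∞)⁻¹ else 0

/-- The law of the sojourn time `ν_j` in state `j`, that is, of `η + (1 - η) X` with `X`
a `Beta(1, j)` random variable. -/
def sojournLaw (η : ℝ) (j : ℕ) : Measure ℝ :=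
  (betaMeasure 1 j).map fun x => η + (1 - η) * x

variable {Ω : Type*}

/-- The sigma-algebra generated by `U 0, …, U m` and `θ 1, …, θ m`. -/
@[reducible] def history (U : ℕ → Ω → ℕ) (θ : ℕ → Ω → ℝ) (m : ℕ) : MeasurableSpace Ω :=
  (⨆ i ∈ Set.Iic m, MeasurableSpace.comap (U i) inferInstance) ⊔
    (⨆ i ∈ Set.Icc 1 m, MeasurableSpace.comap (θ i) inferInstance)

/-- `U m` (`m ≥ 0`) and `θ m` (`m ≥ 1`) are the states and the inter-transmission times of the
Markov renewal process with `U 0 = 1`: given the history up to the `m`-th transmission with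
`U m = i`, the next state is `j` with probability `stepProb R i j`, and the time until the next
transmission has law `sojournLaw η i`, independently of the next state. -/
structure IsTrickleProcess [MeasurableSpace Ω] (R : ℕ) (η : ℝ) (μ : Measure Ω)
    (U : ℕ → Ω → ℕ) (θ : ℕ → Ω → ℝ) : Prop where
  measurable_state : ∀ m, Measurable (U m)
  measurable_time : ∀ m, Measurable (θ m)
  initial : ∀ᵐ ω ∂μ, U 0 ω = 1
  transition : ∀ (m i j : ℕ) (E : Set Ω) (S : Set ℝ),
    MeasurableSet[history U θ m] E → MeasurableSet S →
      μ (E ∩ {ω | U m ω = i} ∩ {ω | U (m + 1) ω = j ∧ θ (m + 1) ω ∈ S}) =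
        μ (E ∩ {ω | U m ω = i}) * (stepProb R i j * sojournLaw η i S)

/-- `A(m) = U 1 + ⋯ + U m`, the number of nodes (other than node 0) updated by the first `m`
transmissions. -/
def updatedNodes (U : ℕ → Ω → ℕ) (m : ℕ) (ω : Ω) : ℕ :=
  ∑ i ∈ Finset.Icc 1 m, U i ω

/-- `T_m = θ 1 + ⋯ + θ m`, the time of the `m`-th transmission. -/
def transmissionTime (θ : ℕ → Ω → ℝ) (m : ℕ) (ω : Ω) : ℝ :=
  ∑ i ∈ Finset.Icc 1 m, θ i ω

/-- The hop count `H⁽ⁿ⁾ = min {m : U 1 + ⋯ + U m ≥ n}`. -/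
def hopCount (U : ℕ → Ω → ℕ) (n : ℕ) (ω : Ω) : ℕ :=
  sInf {m | n ≤ updatedNodes U m ω}

/-- The end-to-end delay `T⁽ⁿ⁾`, the time of transmission number `H⁽ⁿ⁾`. -/
def endToEndDelay (U : ℕ → Ω → ℕ) (θ : ℕ → Ω → ℝ) (n : ℕ) (ω : Ω) : ℝ :=
  transmissionTime θ (hopCount U n ω) ω

/-- `B(t) = A(m)` for `T_m ≤ t < T_{m+1}`: the number of nodes (other than node 0) that are
updated at time `t`. -/
def updatedNodesAt (U : ℕ → Ω → ℕ) (θ : ℕ → Ω → ℝ) (t : ℝ) (ω : Ω) : ℕ :=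
  updatedNodes U (sSup {m | transmissionTime θ m ω ≤ t}) ω

/-- The index at which the chain enters state `i` for the first time (`0` if it starts there). -/
def firstEntry (U : ℕ → Ω → ℕ) (i : ℕ) (ω : Ω) : ℕ :=
  sInf {m | U m ω = i}

/-- `η_{ij}`: the number of transitions between entering state `i` and then entering state `j`
for the first time (at least one transition is made, also if `j = i`). -/
def passageSteps (U : ℕ → Ω → ℕ) (i j : ℕ) (ω : Ω) : ℕ :=
  sInf {k | 1 ≤ k ∧ U (firstEntry U i ω + k) ω = j}

/-- The time elapsed during the `η_{ij}` transitions from state `i` to state `j`. -/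
def passageTime (U : ℕ → Ω → ℕ) (θ : ℕ → Ω → ℝ) (i j : ℕ) (ω : Ω) : ℝ :=
  transmissionTime θ (firstEntry U i ω + passageSteps U i j ω) ω -
    transmissionTime θ (firstEntry U i ω) ω

/-- The number of nodes updated during the `η_{ij}` transitions from state `i` to state `j`.
The subtraction does not truncate, because `updatedNodesAt` is nondecreasing along the process. -/
def passageNodes (U : ℕ → Ω → ℕ) (θ : ℕ → Ω → ℝ) (i j : ℕ) (ω : Ω) : ℕ :=
  updatedNodesAt U θ
      (transmissionTime θ (firstEntry U i ω + passageSteps U i j ω) ω) ω -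
    updatedNodesAt U θ (transmissionTime θ (firstEntry U i ω) ω) ω

/-- The joint transform `G_{(X, Y)}[z, s] = E[z ^ X e ^ (s Y)]`. -/
def jointTransform [MeasurableSpace Ω] (μ : Measure Ω) (X : Ω → ℕ) (Y : Ω → ℝ) (z s : ℂ) : ℂ :=
  ∫ ω, z ^ X ω * Complex.exp (s * Y ω) ∂μ

/-- `G_{ij}[z, s]`, the joint transform of the number of nodes updated and the time elapsed
between entering state `i` and entering state `j`. -/
def passageTransform [MeasurableSpace Ω] (μ : Measure Ω) (U : ℕ → Ω → ℕ) (θ : ℕ → Ω → ℝ)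
    (i j : ℕ) (z s : ℂ) : ℂ :=
  jointTransform μ (passageNodes U θ i j) (passageTime U θ i j) z s

/-- `M_{ν_j}(s) = E[e ^ (s ν_j)]`. -/
def sojournMGF (η : ℝ) (j : ℕ) (s : ℂ) : ℂ :=
  complexMGF id (sojournLaw η j) s

/-- `𝒯[z, s] = ∑ₙ M_{T⁽ⁿ⁾}[s] z ^ n`. -/
def delayTransform [MeasurableSpace Ω] (μ : Measure Ω) (U : ℕ → Ω → ℕ) (θ : ℕ → Ω → ℝ)
    (z s : ℂ) : ℂ :=
  ∑' n : ℕ, complexMGF (endToEndDelay U θ n) μ s * z ^ n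

end Trickle

end

/-! Attach to each transition i → l the weight p_il E[g(ν_i)] c(l), and let K be the matrix of these
weights for g(x) = e^(sx), c(l) = z^l (`weightMatrix`). By the Markov property, (K^m)_1l is the
expectation of z^(A(m)) e^(s T_m) on {U_m = l} (`setIntegral_pathWeight`).

Hop count m + 1 belongs exactly to the n with A(m) < n ≤ A(m+1). Summing z^n over this block is a
geometric sum, so (1 - z) times its contribution to 𝒯 is z (∑_l (K^m)_1l M_{ν_l} - ∑_l (K^(m+1))_1l)
(`one_sub_mul_tsum_delayTerm_succ`). Hop count 0 contributes 1. Summing over m leaves M_{ν_1} + ∑_j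
S_j (M_{ν_j} - 1) with S_j = ∑_m (K^(m+1))_1j.

Splitting paths at their first visit to j gives the renewal identity S_j = F_1j / (1 - F_jj), where
F_ij is the total first-passage weight (`tsum_pow_succ_eq_div`). Moreover F_ij = G_ij: the Markov
property at the first entry into i factors out the probability of the entry index, and these
probabilities sum to 1 because every state is reached almost surely
(`integrable_and_integral_passage`).

All rearrangements are justified by the nonnegative matrix B built from |e^(sx)| and |z|^l. Its
block sums dominate the row sums of B^(m+1), so convergence of the series in |z| makes the powers
summable from state 1, and then on the diagonal at every j, via 1 → R → j. Part (d) is uniqueness of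
power series coefficients, the radius being positive since 0 ≤ T⁽ⁿ⁾ ≤ n almost surely. -/

namespace Trickle

/-! ### Renewal algebra for first-passage weights of a matrix -/

section Renewal

variable {ι 𝕜 : Type*} [Fintype ι] [DecidableEq ι] [RCLike 𝕜]

/-- The matrix obtained from `A` by forbidding transitions into the state `j`. -/
def avoiding {ι 𝕜 : Type*} [DecidableEq ι] [Zero 𝕜] (A : Matrix ι ι 𝕜) (j : ι) : Matrix ι ι 𝕜 :=
  Matrix.of fun i l => if l = j then 0 else A i l

/-- The total weight of the paths from `i` that reach `j` for the first time after `k + 1` steps. -/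
def firstPassage {ι 𝕜 : Type*} [Fintype ι] [DecidableEq ι] [Semiring 𝕜] (A : Matrix ι ι 𝕜)
    (i j : ι) (k : ℕ) : 𝕜 :=
  (avoiding A j ^ k * A) i j

theorem firstPassage_succ (A : Matrix ι ι 𝕜) (i j : ι) (k : ℕ) :
    firstPassage A i j (k + 1) = ∑ l, avoiding A j i l * firstPassage A l j k := by
  rw [firstPassage, pow_succ', mul_assoc, Matrix.mul_apply]
  rfl

/-- A path ending in j splits uniquely at its first visit to j. The induction conditions on the
first step: either it enters j at once, which is the term k = 0, or it is a step of `avoiding A j`.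
-/
theorem pow_succ_apply_eq_sum_firstPassage (A : Matrix ι ι 𝕜) (i j : ι) (m : ℕ) :
    (A ^ (m + 1)) i j =
      ∑ k ∈ Finset.range (m + 1), firstPassage A i j k * (A ^ (m - k)) j j := by
  induction m generalizing i with
  | zero => simp [firstPassage]
  | succ m ih =>
    have h : ∀ l, A i l * (A ^ (m + 1)) l j =
        avoiding A j i l * (A ^ (m + 1)) l j + if l = j then A i j * (A ^ (m + 1)) j j else 0 := by
      intro l
      by_cases hl : l = j <;> simp [avoiding, hl]
    rw [pow_succ', Matrix.mul_apply, Finset.sum_congr rfl fun l _ => h l, Finset.sum_add_distrib,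
      Finset.sum_ite_eq' Finset.univ j, if_pos (Finset.mem_univ j), Finset.sum_range_succ']
    congr 1
    · simp_rw [ih, Finset.mul_sum, firstPassage_succ, Finset.sum_mul]
      rw [Finset.sum_comm]
      refine Finset.sum_congr rfl fun k _ => Finset.sum_congr rfl fun l _ => ?_
      rw [Nat.succ_sub_succ, mul_assoc]
    · simp [firstPassage]

theorem norm_mul_apply_le {ι 𝕜 : Type*} [Fintype ι] [RCLike 𝕜] {A A' : Matrix ι ι 𝕜}
    {B B' : Matrix ι ι ℝ}
    (h : ∀ i j, ‖A i j‖ ≤ B i j) (h' : ∀ i j, ‖A' i j‖ ≤ B' i j) (i j : ι) :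
    ‖(A * A') i j‖ ≤ (B * B') i j := by
  rw [Matrix.mul_apply, Matrix.mul_apply]
  refine (norm_sum_le _ _).trans (Finset.sum_le_sum fun l _ => ?_)
  rw [norm_mul]
  exact mul_le_mul (h i l) (h' l j) (norm_nonneg _) ((norm_nonneg _).trans (h i l))

theorem norm_pow_apply_le {A : Matrix ι ι 𝕜} {B : Matrix ι ι ℝ}
    (h : ∀ i j, ‖A i j‖ ≤ B i j) (m : ℕ) (i j : ι) : ‖(A ^ m) i j‖ ≤ (B ^ m) i j := by
  induction m generalizing i j with
  | zero => by_cases hij : i = j <;> simp [hij]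
  | succ m ih =>
    rw [pow_succ, pow_succ]
    exact norm_mul_apply_le ih h i j

theorem norm_avoiding_apply_le {ι 𝕜 : Type*} [DecidableEq ι] [RCLike 𝕜] {A : Matrix ι ι 𝕜}
    {B : Matrix ι ι ℝ}
    (h : ∀ i j, ‖A i j‖ ≤ B i j) (j i l : ι) : ‖avoiding A j i l‖ ≤ B i l := by
  by_cases hl : l = j
  · simpa [avoiding, hl] using (norm_nonneg _).trans (h i j)
  · simpa [avoiding, hl] using h i l

/-- Forgetting the avoidance constraint only enlarges the majorant, so summable powers of `B` make
the first-passage series converge absolutely. -/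
theorem norm_firstPassage_le {A : Matrix ι ι 𝕜} {B : Matrix ι ι ℝ}
    (h : ∀ i j, ‖A i j‖ ≤ B i j) (i j : ι) (k : ℕ) :
    ‖firstPassage A i j k‖ ≤ (B ^ (k + 1)) i j := by
  rw [pow_succ]
  exact norm_mul_apply_le (norm_pow_apply_le (norm_avoiding_apply_le h j) k) h i j

theorem norm_firstPassage_le_firstPassage {A : Matrix ι ι 𝕜} {B : Matrix ι ι ℝ}
    (h : ∀ i j, ‖A i j‖ ≤ B i j) (i j : ι) (k : ℕ) :
    ‖firstPassage A i j k‖ ≤ firstPassage B i j k := by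
  refine norm_mul_apply_le (norm_pow_apply_le (fun i l => ?_) k) h i j
  by_cases hl : l = j <;> simp [avoiding, hl, h]

/-- Summability of the powers along one starting state propagates to every state that can be
reached from it. -/
theorem summable_pow_diag {B : Matrix ι ι ℝ} (hB : ∀ i j, 0 ≤ B i j) {i₀ j : ι}
    (hsum : Summable fun m => (B ^ m) i₀ j) {k : ℕ} (hk : 0 < (B ^ k) i₀ j) :
    Summable fun m => (B ^ m) j j := by
  have hn : ∀ i j, ‖B i j‖ ≤ B i j := fun i j => (Real.norm_of_nonneg (hB i j)).le
  have hpow : ∀ m i j, 0 ≤ (B ^ m) i j := fun m i j =>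
    (norm_nonneg _).trans (norm_pow_apply_le hn m i j)
  refine (summable_mul_left_iff hk.ne').1 (Summable.of_nonneg_of_le
    (fun m => mul_nonneg hk.le (hpow m j j)) (fun m => ?_) ((summable_nat_add_iff k).2 hsum))
  rw [add_comm, pow_add, Matrix.mul_apply]
  exact Finset.single_le_sum (f := fun l => (B ^ k) i₀ l * (B ^ m) l j)
    (fun l _ => mul_nonneg (hpow k i₀ l) (hpow m l j)) (Finset.mem_univ j)

theorem tsum_pow_succ_eq_tsum_firstPassage_mul {A : Matrix ι ι 𝕜} {B : Matrix ι ι ℝ}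
    (h : ∀ i j, ‖A i j‖ ≤ B i j) {i j : ι} (hi : Summable fun m => (B ^ m) i j)
    (hj : Summable fun m => (B ^ m) j j) :
    ∑' m, (A ^ (m + 1)) i j = (∑' k, firstPassage A i j k) * ∑' m, (A ^ m) j j := by
  rw [tsum_mul_tsum_eq_tsum_sum_range_of_summable_norm]
  · exact tsum_congr fun m => pow_succ_apply_eq_sum_firstPassage A i j m
  · exact Summable.of_nonneg_of_le (fun _ => norm_nonneg _) (norm_firstPassage_le h i j)
      ((summable_nat_add_iff 1).2 hi)
  · exact Summable.of_nonneg_of_le (fun _ => norm_nonneg _) (fun m => norm_pow_apply_le h m j j) hj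

/-- The renewal equation: the paths from `i` that end in `j` decompose into a first passage to `j`
followed by returns to `j`. -/
theorem tsum_pow_succ_eq_div {A : Matrix ι ι 𝕜} {B : Matrix ι ι ℝ}
    (h : ∀ i j, ‖A i j‖ ≤ B i j) {i j : ι} (hi : Summable fun m => (B ^ m) i j)
    (hj : Summable fun m => (B ^ m) j j) :
    (∑' k, firstPassage A j j k) ≠ 1 ∧
      ∑' m, (A ^ (m + 1)) i j =
        (∑' k, firstPassage A i j k) / (1 - ∑' k, firstPassage A j j k) := by
  have hA : Summable fun m => (A ^ m) j j :=
    Summable.of_norm_bounded hj fun m => norm_pow_apply_le h m j j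
  have h1 := tsum_pow_succ_eq_tsum_firstPassage_mul h hj hj
  have h0 := hA.tsum_eq_zero_add
  rw [h1, pow_zero, Matrix.one_apply_eq] at h0
  -- With F the return weight and S the full diagonal series, S = 1 + F S. Hence (1 - F) S = 1,
  -- which both excludes F = 1 and evaluates S.
  have h2 : (1 - ∑' k, firstPassage A j j k) * ∑' m, (A ^ m) j j = 1 := by
    linear_combination h0
  have h3 : 1 - ∑' k, firstPassage A j j k ≠ 0 := left_ne_zero_of_mul_eq_one h2
  refine ⟨fun h4 => h3 (by rw [h4, sub_self]), ?_⟩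
  rw [tsum_pow_succ_eq_tsum_firstPassage_mul h hi hj, eq_div_iff h3, mul_assoc, mul_comm _ (1 - _),
    h2, mul_one]

/-- The power m = 0 is the identity and yields `v i`; after this shift both series run over the same
powers and combine into the factor `v l - 1`. -/
theorem tsum_pow_mul_sub_pow_succ {K : Matrix ι ι 𝕜} {i : ι}
    (hK : ∀ l, Summable fun m => (K ^ m) i l) (v : ι → 𝕜) :
    ∑' m, (∑ l, (K ^ m) i l * v l - ∑ l, (K ^ (m + 1)) i l) =
      v i + ∑ l, (∑' m, (K ^ (m + 1)) i l) * (v l - 1) := by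
  have hK1 : ∀ l, HasSum (fun m => (K ^ (m + 1)) i l) (∑' m, (K ^ (m + 1)) i l) := fun l =>
    ((summable_nat_add_iff 1).2 (hK l)).hasSum
  have h0 : ∀ l, ∑' m, (K ^ m) i l = (1 : Matrix ι ι 𝕜) i l + ∑' m, (K ^ (m + 1)) i l := fun l => by
    rw [(hK l).tsum_eq_zero_add, pow_zero]
  have h1 : HasSum (fun m => ∑ l, (K ^ m) i l * v l) (∑ l, (∑' m, (K ^ m) i l) * v l) :=
    hasSum_sum fun l _ => (hK l).hasSum.mul_right (v l)
  have h2 : HasSum (fun m => ∑ l, (K ^ (m + 1)) i l) (∑ l, ∑' m, (K ^ (m + 1)) i l) :=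
    hasSum_sum fun l _ => hK1 l
  rw [(h1.sub h2).tsum_eq]
  simp_rw [h0, add_mul, mul_sub, mul_one, Finset.sum_add_distrib, Finset.sum_sub_distrib,
    Matrix.one_apply, ite_mul, one_mul, zero_mul, Finset.sum_ite_eq, Finset.mem_univ, if_true]
  ring

end Renewal

/-! ### Support and integrability of the sojourn laws -/

section Sojourn

theorem isProbabilityMeasure_sojournLaw (η : ℝ) {j : ℕ} (hj : 1 ≤ j) :
    IsProbabilityMeasure (sojournLaw η j) := by
  have := isProbabilityMeasureBeta (α := 1) (β := j) one_pos (by exact_mod_cast hj)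
  exact Measure.isProbabilityMeasure_map (by fun_prop)

/-- Positivity will make the transmission times strictly increasing, and the upper bound makes
continuous functions of a sojourn time bounded. The endpoint 1 must be allowed, since it is the only
value when η = 1. -/
theorem ae_sojournLaw_mem_Ioc {η : ℝ} (hη : η ∈ Set.Icc (0 : ℝ) 1) (j : ℕ) :
    ∀ᵐ x ∂sojournLaw η j, x ∈ Set.Ioc (0 : ℝ) 1 := by
  have h : ∀ᵐ x ∂betaMeasure 1 j, x ∈ Set.Ioo (0 : ℝ) 1 := by
    rw [betaMeasure, ae_withDensity_iff (by unfold betaPDF; fun_prop)]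
    refine Filter.Eventually.of_forall fun x hx => ⟨?_, ?_⟩
    · by_contra! h0
      exact hx (betaPDF_eq_zero_of_nonpos h0)
    · by_contra! h0
      exact hx (betaPDF_eq_zero_of_one_le h0)
  refine (ae_map_iff (p := (· ∈ Set.Ioc (0 : ℝ) 1)) (by fun_prop) measurableSet_Ioc).2 ?_
  filter_upwards [h] with x hx
  obtain ⟨hx0, hx1⟩ := hx
  obtain ⟨h0, h1⟩ := hη
  refine ⟨?_, by nlinarith⟩
  rcases h0.eq_or_lt with rfl | h0
  · simpa using hx0
  · nlinarith

theorem integrable_sojournLaw {𝕜 : Type*} [RCLike 𝕜] {η : ℝ} (hη : η ∈ Set.Icc (0 : ℝ) 1)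
    {j : ℕ} (hj : 1 ≤ j) {g : ℝ → 𝕜} (hg : Continuous g) : Integrable g (sojournLaw η j) := by
  have := isProbabilityMeasure_sojournLaw η hj
  obtain ⟨C, hC⟩ := isCompact_Icc.exists_bound_of_continuousOn (hg.continuousOn (s := Set.Icc 0 1))
  refine Integrable.of_bound hg.aestronglyMeasurable C ?_
  filter_upwards [ae_sojournLaw_mem_Ioc hη j] with x hx
  exact hC x ⟨hx.1.le, hx.2⟩

end Sojourn

/-! ### Path weights and the Markov property -/

section History

variable {Ω : Type*} {U : ℕ → Ω → ℕ} {θ : ℕ → Ω → ℝ}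

theorem measurable_state_history {i m : ℕ} (h : i ≤ m) : Measurable[history U θ m] (U i) :=
  Measurable.of_comap_le (le_sup_of_le_left (le_iSup₂_of_le i h le_rfl))

theorem measurable_time_history {i m : ℕ} (h1 : 1 ≤ i) (h : i ≤ m) :
    Measurable[history U θ m] (θ i) :=
  Measurable.of_comap_le (le_sup_of_le_right (le_iSup₂_of_le i ⟨h1, h⟩ le_rfl))

theorem history_mono {m n : ℕ} (h : m ≤ n) : history U θ m ≤ history U θ n :=
  sup_le (iSup₂_le fun _ hi => (measurable_state_history (le_trans hi h)).comap_le)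
    (iSup₂_le fun _ hi => (measurable_time_history hi.1 (hi.2.trans h)).comap_le)

theorem measurableSet_state_eq_history {i m : ℕ} (h : i ≤ m) (l : ℕ) :
    MeasurableSet[history U θ m] {ω | U i ω = l} :=
  measurable_state_history h (measurableSet_singleton l)

end History

/-- The matrix of the weights `p_{il} E[g(ν_i)] c(l)` of the transitions of the process. -/
noncomputable def weightMatrix {𝕜 : Type*} [RCLike 𝕜] (R : ℕ) (η : ℝ) (g : ℝ → 𝕜) (c : ℕ → 𝕜) :
    Matrix (Finset.Icc 1 R) (Finset.Icc 1 R) 𝕜 :=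
  Matrix.of fun i l => ((stepProb R i l).toReal : 𝕜) * (∫ x, g x ∂sojournLaw η i) * c l

theorem norm_weightMatrix_le {𝕜 : Type*} [RCLike 𝕜] (R : ℕ) (η : ℝ) (g : ℝ → 𝕜) (c : ℕ → 𝕜)
    (i l : Finset.Icc 1 R) :
    ‖weightMatrix R η g c i l‖ ≤ weightMatrix R η (fun x => ‖g x‖) (fun l => ‖c l‖) i l := by
  simp only [weightMatrix, Matrix.of_apply, norm_mul, RCLike.norm_ofReal,
    abs_of_nonneg ENNReal.toReal_nonneg, RCLike.ofReal_real_eq_id, id]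
  gcongr
  exact norm_integral_le_integral_norm _

/-- Avoidance is absorbed into the state weight, so every statement about powers of a `weightMatrix`
also covers paths that avoid `j`. -/
theorem avoiding_weightMatrix {𝕜 : Type*} [RCLike 𝕜] (R : ℕ) (η : ℝ) (g : ℝ → 𝕜) (c : ℕ → 𝕜)
    (j : Finset.Icc 1 R) :
    avoiding (weightMatrix R η g c) j =
      weightMatrix R η g fun l => if l = (j : ℕ) then 0 else c l := by
  ext i l
  by_cases hl : l = j
  · simp [avoiding, weightMatrix, hl]
  · simp [avoiding, weightMatrix, hl]

/-- The product of the weights `c (U m) * g (θ m)` over `k` transitions starting at index `a`. -/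
def pathWeight {Ω 𝕜 : Type*} [CommMonoid 𝕜] (U : ℕ → Ω → ℕ) (θ : ℕ → Ω → ℝ) (g : ℝ → 𝕜)
    (c : ℕ → 𝕜) (a k : ℕ) (ω : Ω) : 𝕜 :=
  ∏ t ∈ Finset.range k, c (U (a + t + 1) ω) * g (θ (a + t + 1) ω)

theorem measurable_pathWeight_history {Ω 𝕜 : Type*} [RCLike 𝕜] {U : ℕ → Ω → ℕ} {θ : ℕ → Ω → ℝ}
    {g : ℝ → 𝕜} (hg : Continuous g) (c : ℕ → 𝕜) (a k : ℕ) :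
    Measurable[history U θ (a + k)] (pathWeight U θ g c a k) := by
  refine Finset.measurable_fun_prod _ fun t ht => ?_
  have ht' := Finset.mem_range.1 ht
  exact ((measurable_of_countable c).comp (measurable_state_history (by omega))).mul
    (hg.measurable.comp (measurable_time_history (by omega) (by omega)))

theorem stepProb_ne_top {R i l : ℕ} (hi : 1 ≤ i) : stepProb R i l ≠ ∞ := by
  unfold stepProb
  split_ifs
  · exact ENNReal.inv_ne_top.2 (by exact_mod_cast (by omega : i ≠ 0))
  · exact ENNReal.zero_ne_top

namespace IsTrickleProcess

variable {Ω : Type*} [MeasurableSpace Ω] {R : ℕ} {η : ℝ} {μ : Measure Ω}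
  {U : ℕ → Ω → ℕ} {θ : ℕ → Ω → ℝ}

theorem history_le (h : IsTrickleProcess R η μ U θ) (m : ℕ) : history U θ m ≤ ‹_› :=
  sup_le (iSup₂_le fun i _ => (h.measurable_state i).comap_le)
    (iSup₂_le fun i _ => (h.measurable_time i).comap_le)

theorem measurableSet_state_eq (h : IsTrickleProcess R η μ U θ) (m l : ℕ) :
    MeasurableSet {ω | U m ω = l} :=
  h.measurable_state m (measurableSet_singleton l)

theorem ae_state_mem (h : IsTrickleProcess R η μ U θ) (hR : 1 ≤ R) :
    ∀ᵐ ω ∂μ, ∀ m, U m ω ∈ Finset.Icc 1 R := by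
  refine ae_all_iff.2 fun m => ?_
  induction m with
  | zero =>
    filter_upwards [h.initial] with ω hω
    simp [hω, hR]
  | succ m ih =>
    have h1 : ∀ i j, ∀ᵐ ω ∂μ, i ∈ Finset.Icc 1 R → j ∉ Finset.Icc 1 R →
        ¬ (U m ω = i ∧ U (m + 1) ω = j) := by
      intro i j
      by_cases hij : i ∈ Finset.Icc 1 R ∧ j ∉ Finset.Icc 1 R
      · have h2 := h.transition m i j Set.univ Set.univ MeasurableSet.univ MeasurableSet.univ
        have h3 : stepProb R i j = 0 := by
          rw [stepProb, if_neg]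
          simp only [Finset.mem_Icc] at hij
          omega
        rw [h3, zero_mul, mul_zero] at h2
        refine (measure_eq_zero_iff_ae_notMem.1 h2).mono fun ω hω _ _ h4 => hω ?_
        simpa using h4
      · exact Filter.Eventually.of_forall fun ω hi hj => absurd ⟨hi, hj⟩ hij
    filter_upwards [ih, ae_all_iff.2 fun i => ae_all_iff.2 (h1 i)] with ω hω h2
    by_contra hcon
    exact h2 _ _ hω hcon ⟨rfl, rfl⟩

theorem ae_time_mem (h : IsTrickleProcess R η μ U θ) (hη : η ∈ Set.Icc (0 : ℝ) 1) :
    ∀ᵐ ω ∂μ, ∀ m, θ (m + 1) ω ∈ Set.Ioc (0 : ℝ) 1 := by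
  refine ae_all_iff.2 fun m => ?_
  have h1 : ∀ i j, ∀ᵐ ω ∂μ, ¬ (U m ω = i ∧ U (m + 1) ω = j ∧ θ (m + 1) ω ∉ Set.Ioc (0 : ℝ) 1) := by
    intro i j
    have h2 := h.transition m i j Set.univ (Set.Ioc (0 : ℝ) 1)ᶜ MeasurableSet.univ
      measurableSet_Ioc.compl
    have h3 : sojournLaw η i (Set.Ioc (0 : ℝ) 1)ᶜ = 0 := ae_sojournLaw_mem_Ioc hη i
    rw [h3, mul_zero, mul_zero] at h2
    refine (measure_eq_zero_iff_ae_notMem.1 h2).mono fun ω hω h4 => hω ?_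
    simpa using h4
  filter_upwards [ae_all_iff.2 fun i => ae_all_iff.2 (h1 i)] with ω h2
  by_contra hcon
  exact h2 _ _ ⟨rfl, rfl, hcon⟩

variable {𝕜 : Type*} [RCLike 𝕜]

/-- The transition axiom on rectangles identifies the joint law of `X` and `θ (m + 1)`, restricted
to the two state events, as a product measure; the integral then factors. -/
theorem setIntegral_transition [IsFiniteMeasure μ] (h : IsTrickleProcess R η μ U θ) {m i : ℕ}
    (hi : 1 ≤ i) (l : ℕ) {X : Ω → 𝕜} (hX : Measurable[history U θ m] X) {g : ℝ → 𝕜}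
    (hg : Continuous g) :
    ∫ ω in {ω | U m ω = i} ∩ {ω | U (m + 1) ω = l}, X ω * g (θ (m + 1) ω) ∂μ =
      (∫ ω in {ω | U m ω = i}, X ω ∂μ) *
        (((stepProb R i l).toReal : 𝕜) * ∫ x, g x ∂sojournLaw η i) := by
  have := isProbabilityMeasure_sojournLaw η hi
  have hX' : Measurable X := hX.mono (h.history_le m) le_rfl
  have hθ := h.measurable_time (m + 1)
  have hfin : IsFiniteMeasure (stepProb R i l • sojournLaw η i) :=
    Measure.smul_finite _ (stepProb_ne_top hi)
  have key : ((μ.restrict {ω | U m ω = i}).map X).prod (stepProb R i l • sojournLaw η i) =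
      (μ.restrict ({ω | U m ω = i} ∩ {ω | U (m + 1) ω = l})).map
        fun ω => (X ω, θ (m + 1) ω) := by
    refine Measure.prod_eq fun A S hA hS => ?_
    rw [Measure.map_apply (hX'.prodMk hθ) (hA.prod hS), Measure.map_apply hX' hA,
      Measure.restrict_apply ((hX'.prodMk hθ) (hA.prod hS)), Measure.restrict_apply (hX' hA),
      Measure.smul_apply, smul_eq_mul, ← h.transition m i l (X ⁻¹' A) S (hX hA) hS]
    congr 1
    ext ω
    simp only [Set.mem_inter_iff, Set.mem_preimage, Set.mem_prod, Set.mem_ofPred_eq]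
    tauto
  have h1 := integral_prod_mul (μ := (μ.restrict {ω | U m ω = i}).map X)
    (ν := stepProb R i l • sojournLaw η i) (fun x : 𝕜 => x) g
  rw [key, integral_map (hX'.prodMk hθ).aemeasurable
      (by fun_prop), integral_map hX'.aemeasurable (by fun_prop),
    integral_smul_measure] at h1
  rw [h1, RCLike.real_smul_eq_coe_mul]

theorem ae_norm_factor_le (h : IsTrickleProcess R η μ U θ) (hR : 1 ≤ R)
    (hη : η ∈ Set.Icc (0 : ℝ) 1) {g : ℝ → 𝕜} (hg : Continuous g) (c : ℕ → 𝕜) :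
    ∃ C, ∀ᵐ ω ∂μ, ∀ m, ‖c (U (m + 1) ω) * g (θ (m + 1) ω)‖ ≤ C := by
  obtain ⟨C, hC⟩ := isCompact_Icc.exists_bound_of_continuousOn (hg.continuousOn (s := Set.Icc 0 1))
  refine ⟨(∑ l ∈ Finset.Icc 1 R, ‖c l‖) * C, ?_⟩
  filter_upwards [h.ae_state_mem hR, h.ae_time_mem hη] with ω h1 h2 m
  rw [norm_mul]
  exact mul_le_mul (Finset.single_le_sum (f := fun l => ‖c l‖) (fun _ _ => norm_nonneg _) (h1 _))
    (hC _ ⟨(h2 m).1.le, (h2 m).2⟩) (norm_nonneg _) (Finset.sum_nonneg fun _ _ => norm_nonneg _)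

theorem integrable_mul_factor (h : IsTrickleProcess R η μ U θ) (hR : 1 ≤ R)
    (hη : η ∈ Set.Icc (0 : ℝ) 1) {X : Ω → 𝕜} (hX : Integrable X μ) {g : ℝ → 𝕜}
    (hg : Continuous g) (c : ℕ → 𝕜) (m : ℕ) :
    Integrable (fun ω => X ω * (c (U (m + 1) ω) * g (θ (m + 1) ω))) μ := by
  obtain ⟨C, hC⟩ := h.ae_norm_factor_le hR hη hg c
  refine hX.mul_bdd (c := C) (Measurable.aestronglyMeasurable ?_) (hC.mono fun ω hω => hω m)
  exact ((measurable_of_countable c).comp (h.measurable_state _)).mul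
    (hg.measurable.comp (h.measurable_time _))

theorem integrable_pathWeight [IsFiniteMeasure μ] (h : IsTrickleProcess R η μ U θ) (hR : 1 ≤ R)
    (hη : η ∈ Set.Icc (0 : ℝ) 1) {g : ℝ → 𝕜} (hg : Continuous g) (c : ℕ → 𝕜) (a k : ℕ) :
    Integrable (pathWeight U θ g c a k) μ := by
  induction k with
  | zero => exact integrable_const (1 : 𝕜)
  | succ k ih =>
    have := h.integrable_mul_factor hR hη ih hg c (a + k)
    exact this.congr (.of_forall fun ω => (Finset.prod_range_succ _ _).symm)

/-- Integrals split according to the state at a fixed index. -/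
theorem sum_setIntegral_state (h : IsTrickleProcess R η μ U θ) (hR : 1 ≤ R) {X : Ω → 𝕜}
    {B : Set Ω} (hB : MeasurableSet B) (hX : IntegrableOn X B μ) (m : ℕ) :
    ∑ i : Finset.Icc 1 R, ∫ ω in {ω | U m ω = i} ∩ B, X ω ∂μ = ∫ ω in B, X ω ∂μ := by
  rw [← integral_iUnion_fintype]
  · refine setIntegral_congr_set ?_
    filter_upwards [h.ae_state_mem hR] with ω hω
    refine propext ⟨fun h1 => ?_, fun h1 => ?_⟩
    · exact (Set.mem_iUnion.1 h1).choose_spec.2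
    · exact Set.mem_iUnion.2 ⟨⟨U m ω, hω m⟩, rfl, h1⟩
  · exact fun i => (h.measurableSet_state_eq m i).inter hB
  · intro i j hij
    refine Set.disjoint_left.2 fun ω h1 h2 => hij (Subtype.ext ?_)
    exact h1.1.symm.trans h2.1
  · exact fun i => hX.mono_set Set.inter_subset_right

/-- One transition acts on the vector of expectations split by current state as right multiplication
by the weight matrix. -/
theorem setIntegral_mul_factor [IsFiniteMeasure μ] (h : IsTrickleProcess R η μ U θ) (hR : 1 ≤ R)
    (hη : η ∈ Set.Icc (0 : ℝ) 1) {m : ℕ} {X : Ω → 𝕜} (hX : Measurable[history U θ m] X)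
    (hXi : Integrable X μ) {g : ℝ → 𝕜} (hg : Continuous g) (c : ℕ → 𝕜) (l : Finset.Icc 1 R) :
    ∫ ω in {ω | U (m + 1) ω = l}, X ω * (c (U (m + 1) ω) * g (θ (m + 1) ω)) ∂μ =
      ∑ i : Finset.Icc 1 R, (∫ ω in {ω | U m ω = i}, X ω ∂μ) * weightMatrix R η g c i l := by
  rw [← h.sum_setIntegral_state hR (h.measurableSet_state_eq _ _)
    (h.integrable_mul_factor hR hη hXi hg c m).integrableOn m]
  refine Finset.sum_congr rfl fun i _ => ?_
  have h1 := h.setIntegral_transition (Finset.mem_Icc.1 i.2).1 l hX hg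
  rw [setIntegral_congr_fun (g := fun ω => c l * (X ω * g (θ (m + 1) ω)))
    ((h.measurableSet_state_eq _ _).inter (h.measurableSet_state_eq _ _)), integral_const_mul, h1,
    weightMatrix, Matrix.of_apply]
  · ring
  · intro ω hω
    have h2 : U (m + 1) ω = l := hω.2
    simp only [h2]
    ring

/-- Iterating the one-step rule gives matrix powers. The event `E` in the past of index `a` allows a
restart at the first entry into a state. -/
theorem setIntegral_indicator_pathWeight [IsFiniteMeasure μ] (h : IsTrickleProcess R η μ U θ)
    (hR : 1 ≤ R) (hη : η ∈ Set.Icc (0 : ℝ) 1) {g : ℝ → 𝕜} (hg : Continuous g) (c : ℕ → 𝕜)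
    {a : ℕ} {E : Set Ω} (hE : MeasurableSet[history U θ a] E) {i : Finset.Icc 1 R}
    (hEi : ∀ ω ∈ E, U a ω = i) (k : ℕ) (l : Finset.Icc 1 R) :
    ∫ ω in {ω | U (a + k) ω = l}, E.indicator (pathWeight U θ g c a k) ω ∂μ =
      (μ.real E : 𝕜) * (weightMatrix R η g c ^ k) i l := by
  induction k generalizing l with
  | zero =>
    have hE' := h.history_le a E hE
    rw [setIntegral_indicator hE']
    by_cases hil : i = l
    · subst hil
      have h1 : {ω | U (a + 0) ω = i} ∩ E = E := Set.inter_eq_right.2 hEi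
      rw [h1]
      simp [pathWeight, RCLike.real_smul_eq_coe_mul]
    · have h1 : {ω | U (a + 0) ω = l} ∩ E = ∅ := by
        refine Set.eq_empty_of_forall_notMem fun ω hω => hil (Subtype.ext ?_)
        exact (hEi ω hω.2).symm.trans hω.1
      rw [h1]
      simp [hil]
  | succ k ih =>
    have h1 := h.setIntegral_mul_factor hR hη (m := a + k)
      (X := E.indicator (pathWeight U θ g c a k))
      ((measurable_pathWeight_history hg c a k).indicator (history_mono (by omega) E hE))
      ((h.integrable_pathWeight hR hη hg c a k).indicator (h.history_le a E hE)) hg c l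
    rw [pow_succ, Matrix.mul_apply, Finset.mul_sum]
    simp_rw [← mul_assoc, ← ih, ← h1]
    refine setIntegral_congr_fun (h.measurableSet_state_eq _ _) fun ω _ => ?_
    by_cases hω : ω ∈ E <;> simp [hω, pathWeight, Finset.prod_range_succ, add_assoc]

/-- The weight of the paths that start in `E`, at index `a` and state `i`, and make `k + 1`
transitions, the last of which is the first one into `j`. -/
theorem setIntegral_firstPassage [IsFiniteMeasure μ] (h : IsTrickleProcess R η μ U θ)
    (hR : 1 ≤ R) (hη : η ∈ Set.Icc (0 : ℝ) 1) {g : ℝ → 𝕜} (hg : Continuous g) (c : ℕ → 𝕜)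
    {a : ℕ} {E : Set Ω} (hE : MeasurableSet[history U θ a] E) {i : Finset.Icc 1 R}
    (hEi : ∀ ω ∈ E, U a ω = i) (k : ℕ) (j : Finset.Icc 1 R) :
    ∫ ω in {ω | U (a + k + 1) ω = j},
        E.indicator (pathWeight U θ g (fun l => if l = (j : ℕ) then 0 else c l) a k) ω *
          (c (U (a + k + 1) ω) * g (θ (a + k + 1) ω)) ∂μ =
      (μ.real E : 𝕜) * firstPassage (weightMatrix R η g c) i j k := by
  rw [h.setIntegral_mul_factor hR hη
      ((measurable_pathWeight_history hg _ a k).indicator (history_mono (by omega) E hE))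
      ((h.integrable_pathWeight hR hη hg _ a k).indicator (h.history_le a E hE)) hg c j,
    firstPassage, avoiding_weightMatrix, Matrix.mul_apply, Finset.mul_sum]
  refine Finset.sum_congr rfl fun l _ => ?_
  rw [h.setIntegral_indicator_pathWeight hR hη hg _ hE hEi, mul_assoc]

end IsTrickleProcess

/-! ### Every state is reached almost surely -/

section Avoidance

open Matrix

variable {ι : Type*} [Fintype ι] [DecidableEq ι]

theorem avoiding_mulVec_le {P : Matrix ι ι ℝ} (hP : ∀ i l, 0 ≤ P i l) (j : ι) {v : ι → ℝ}
    (hv : ∀ l, 0 ≤ v l) (i : ι) : (avoiding P j *ᵥ v) i ≤ ∑ l, P i l * v l := by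
  refine Finset.sum_le_sum fun l _ => mul_le_mul_of_nonneg_right ?_ (hv l)
  by_cases hl : l = j <;> simp [avoiding, hl, hP]

theorem avoiding_mulVec_nonneg {P : Matrix ι ι ℝ} (hP : ∀ i l, 0 ≤ P i l) (j : ι) {v : ι → ℝ}
    (hv : ∀ l, 0 ≤ v l) (i : ι) : 0 ≤ (avoiding P j *ᵥ v) i := by
  refine Finset.sum_nonneg fun l _ => mul_nonneg ?_ (hv l)
  by_cases hl : l = j <;> simp [avoiding, hl, hP]

theorem sum_mul_le_of_le {ι : Type*} [Fintype ι] {P : Matrix ι ι ℝ}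
    (hP : ∀ i l, 0 ≤ P i l) (hrow : ∀ i, ∑ l, P i l ≤ 1)
    {v : ι → ℝ} {b : ℝ} (hb : 0 ≤ b) (hv : ∀ l, v l ≤ b) (i r : ι) :
    ∑ l, P i l * v l ≤ b - P i r * (b - v r) := by
  have h1 : P i r * (b - v r) ≤ ∑ l, P i l * (b - v l) :=
    Finset.single_le_sum (f := fun l => P i l * (b - v l))
      (fun l _ => mul_nonneg (hP i l) (sub_nonneg.2 (hv l))) (Finset.mem_univ r)
  simp_rw [mul_sub, Finset.sum_sub_distrib, ← Finset.sum_mul] at h1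
  nlinarith [hrow i]

/-- If every state leads to `r` and `r` leads to `j`, each time with probability at least `δ`,
then `j` is avoided during `2 k` steps with probability at most `(1 - δ ^ 2) ^ k`. -/
theorem avoiding_pow_mulVec_one_le {P : Matrix ι ι ℝ} (hP : ∀ i l, 0 ≤ P i l)
    (hrow : ∀ i, ∑ l, P i l ≤ 1) {δ : ℝ} (hδ : 0 ≤ δ) {j r : ι} (hr : ∀ i, δ ≤ P i r)
    (hj : δ ≤ P r j) (k : ℕ) :
    ∀ i, 0 ≤ ((avoiding P j ^ (2 * k)) *ᵥ 1) i ∧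
      ((avoiding P j ^ (2 * k)) *ᵥ 1) i ≤ (1 - δ ^ 2) ^ k := by
  have hδ1 : δ ≤ 1 := hj.trans
    ((Finset.single_le_sum (fun l _ => hP r l) (Finset.mem_univ j)).trans (hrow r))
  induction k with
  | zero => intro i; simp
  | succ k ih =>
    set v := (avoiding P j ^ (2 * k)) *ᵥ 1
    set b := (1 - δ ^ 2) ^ k
    have hb : 0 ≤ b := pow_nonneg (by nlinarith) k
    have hv : ∀ l, 0 ≤ v l := fun l => (ih l).1
    have hvb : ∀ l, v l ≤ b := fun l => (ih l).2
    have h1 : (avoiding P j ^ (2 * (k + 1))) *ᵥ 1 = avoiding P j *ᵥ (avoiding P j *ᵥ v) := by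
      rw [mulVec_mulVec, mulVec_mulVec, ← pow_two, ← pow_add, mul_add, mul_one, add_comm]
    set w := avoiding P j *ᵥ v
    have hw : ∀ l, 0 ≤ w l := avoiding_mulVec_nonneg hP j hv
    have hwb : ∀ l, w l ≤ b := fun l =>
      (avoiding_mulVec_le hP j hv l).trans ((sum_mul_le_of_le hP hrow hb hvb l l).trans
        (sub_le_self _ (mul_nonneg (hP l l) (sub_nonneg.2 (hvb l)))))
    -- From `r` the forbidden state `j` is hit at once with probability at least `δ`; replacing `v
    -- j` by 0 records that loss.
    have hwr : w r ≤ (1 - δ) * b := by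
      have h2 : w r = ∑ l, P r l * Function.update v j 0 l := by
        refine Finset.sum_congr rfl fun l _ => ?_
        by_cases hl : l = j
        · subst hl; simp [avoiding]
        · simp [avoiding, hl]
      have h3 : ∀ l, Function.update v j 0 l ≤ b := by
        intro l
        by_cases hl : l = j
        · subst hl; simpa using hb
        · simpa [hl] using hvb l
      have h4 := sum_mul_le_of_le hP hrow hb h3 r j
      rw [← h2, Function.update_self, sub_zero] at h4
      nlinarith
    intro i
    rw [h1]
    refine ⟨avoiding_mulVec_nonneg hP j hw i, (avoiding_mulVec_le hP j hw i).trans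
      ((sum_mul_le_of_le hP hrow hb hwb i r).trans ?_)⟩
    -- An arbitrary state moves to `r` with probability at least `δ`, where the deficit is already
    -- `δ * b`. Two steps thus lose the fraction `δ ^ 2`.
    have h5 : δ * (δ * b) ≤ P i r * (b - w r) :=
      mul_le_mul (hr i) (by linarith) (by positivity) (hP i r)
    rw [pow_succ]
    change _ ≤ b * _
    nlinarith

end Avoidance

section Transitions

variable {R : ℕ}

theorem stepProb_toReal (R : ℕ) (i l : ℕ) :
    (stepProb R i l).toReal = if R < i + l ∧ l ≤ R then (i : ℝ)⁻¹ else 0 := by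
  unfold stepProb
  split_ifs <;> simp

theorem sum_stepProb_toReal (i : Finset.Icc 1 R) :
    ∑ l : Finset.Icc 1 R, (stepProb R i l).toReal = 1 := by
  obtain ⟨i, hi⟩ := i
  rw [Finset.mem_Icc] at hi
  simp_rw [stepProb_toReal]
  rw [Finset.sum_coe_sort (Finset.Icc 1 R) fun l => if R < i + l ∧ l ≤ R then (i : ℝ)⁻¹ else 0,
    ← Finset.sum_filter]
  have h1 : (Finset.Icc 1 R).filter (fun l => R < i + l ∧ l ≤ R) = Finset.Icc (R + 1 - i) R := by
    ext l
    simp only [Finset.mem_filter, Finset.mem_Icc]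
    omega
  have h2 : R + 1 - (R + 1 - i) = i := by omega
  have h3 : (i : ℝ) ≠ 0 := by exact_mod_cast (by omega : i ≠ 0)
  rw [h1, Finset.sum_const, Nat.card_Icc, h2, nsmul_eq_mul, mul_inv_cancel₀ h3]

theorem inv_le_stepProb_toReal_of_right {i : ℕ} (hi : i ∈ Finset.Icc 1 R) :
    (R : ℝ)⁻¹ ≤ (stepProb R i R).toReal := by
  rw [Finset.mem_Icc] at hi
  rw [stepProb_toReal, if_pos (by omega)]
  have h1 : (0 : ℝ) < i := by exact_mod_cast hi.1
  exact inv_anti₀ h1 (by exact_mod_cast hi.2)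

theorem stepProb_toReal_of_left {j : ℕ} (hj : j ∈ Finset.Icc 1 R) :
    (stepProb R R j).toReal = (R : ℝ)⁻¹ := by
  rw [Finset.mem_Icc] at hj
  rw [stepProb_toReal, if_pos (by omega)]

theorem weightMatrix_one_apply (η : ℝ) (i l : Finset.Icc 1 R) :
    weightMatrix R η (fun _ => (1 : ℝ)) (fun _ => 1) i l = (stepProb R i l).toReal := by
  have := isProbabilityMeasure_sojournLaw η (Finset.mem_Icc.1 i.2).1
  simp [weightMatrix]

end Transitions

theorem pathWeight_avoiding {Ω 𝕜 : Type*} [CommSemiring 𝕜] (U : ℕ → Ω → ℕ) (θ : ℕ → Ω → ℝ)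
    (g : ℝ → 𝕜) (c : ℕ → 𝕜) (j a k : ℕ) (ω : Ω) :
    pathWeight U θ g (fun l => if l = j then 0 else c l) a k ω =
      {ω | ∀ t < k, U (a + t + 1) ω ≠ j}.indicator (pathWeight U θ g c a k) ω := by
  by_cases hω : ∀ t < k, U (a + t + 1) ω ≠ j
  · rw [Set.indicator_of_mem (by exact hω)]
    refine Finset.prod_congr rfl fun t ht => ?_
    simp only [if_neg (hω t (Finset.mem_range.1 ht))]
  · rw [Set.indicator_of_notMem (by exact hω)]
    push Not at hω
    obtain ⟨t, ht, htj⟩ := hω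
    exact Finset.prod_eq_zero (Finset.mem_range.2 ht) (by simp [htj])

namespace IsTrickleProcess

variable {Ω : Type*} [MeasurableSpace Ω] {R : ℕ} {η : ℝ} {μ : Measure Ω}
  {U : ℕ → Ω → ℕ} {θ : ℕ → Ω → ℝ}

theorem measurableSet_avoid (h : IsTrickleProcess R η μ U θ) (a j k : ℕ) :
    MeasurableSet {ω | ∀ t < k, U (a + t + 1) ω ≠ j} := by
  have : {ω | ∀ t < k, U (a + t + 1) ω ≠ j} =
      ⋂ t, ⋂ (_ : t < k), {ω | U (a + t + 1) ω = j}ᶜ := by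
    ext ω; simp
  rw [this]
  exact MeasurableSet.iInter fun t => MeasurableSet.iInter fun _ =>
    (h.measurableSet_state_eq _ _).compl

/-- With time weight 1 and state weight the indicator of l ≠ j, the path weight is the indicator of
avoidance; summing over the final state gives a row sum. -/
theorem measureReal_avoid [IsFiniteMeasure μ] (h : IsTrickleProcess R η μ U θ) (hR : 1 ≤ R)
    (hη : η ∈ Set.Icc (0 : ℝ) 1) {a : ℕ} {E : Set Ω} (hE : MeasurableSet[history U θ a] E)
    {i : Finset.Icc 1 R} (hEi : ∀ ω ∈ E, U a ω = i) (j : Finset.Icc 1 R) (k : ℕ) :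
    μ.real (E ∩ {ω | ∀ t < k, U (a + t + 1) ω ≠ j}) =
      μ.real E * Matrix.mulVec
        (avoiding (weightMatrix R η (fun _ => (1 : ℝ)) fun _ => 1) j ^ k) 1 i := by
  set c : ℕ → ℝ := fun l => if l = (j : ℕ) then 0 else 1
  have hg : Continuous fun _ : ℝ => (1 : ℝ) := continuous_const
  have hE' := h.history_le a E hE
  have hX := (h.integrable_pathWeight hR hη hg c a k).indicator hE'
  have h1 : E.indicator (pathWeight U θ (fun _ => (1 : ℝ)) c a k) =
      (E ∩ {ω | ∀ t < k, U (a + t + 1) ω ≠ j}).indicator 1 := by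
    rw [← Set.indicator_indicator, funext (pathWeight_avoiding U θ _ _ j a k)]
    congr 2
    ext ω
    simp [pathWeight]
  rw [← integral_indicator_one (hE'.inter (h.measurableSet_avoid a j k)), ← h1, ← setIntegral_univ,
    ← h.sum_setIntegral_state hR MeasurableSet.univ hX.integrableOn (a + k), Matrix.mulVec,
    dotProduct, Finset.mul_sum]
  refine Finset.sum_congr rfl fun l _ => ?_
  rw [Set.inter_univ, h.setIntegral_indicator_pathWeight hR hη hg c hE hEi, avoiding_weightMatrix]
  simp [c]

/-- From every state in `{1, …, R}`, every state is reached almost surely. -/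
theorem ae_exists_state_eq [IsFiniteMeasure μ] (h : IsTrickleProcess R η μ U θ) (hR : 1 ≤ R)
    (hη : η ∈ Set.Icc (0 : ℝ) 1) (j : Finset.Icc 1 R) :
    ∀ᵐ ω ∂μ, ∀ a, ∃ k, U (a + k + 1) ω = j := by
  refine ae_all_iff.2 fun a => ?_
  have key : ∀ i : Finset.Icc 1 R,
      μ.real ({ω | U a ω = i} ∩ {ω | ∀ k, U (a + k + 1) ω ≠ j}) = 0 := by
    intro i
    -- State R serves as a hub: each i jumps to R with probability 1 / i ≥ 1 / R, and R jumps to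
    -- every state with probability 1 / R.
    set δ : ℝ := (R : ℝ)⁻¹
    have hR' : (1 : ℝ) ≤ R := by exact_mod_cast hR
    have hδ : 0 < δ := by positivity
    have hδ1 : δ ≤ 1 := inv_le_one_of_one_le₀ hR'
    have hRmem : R ∈ Finset.Icc 1 R := Finset.mem_Icc.2 ⟨hR, le_rfl⟩
    have h1 : ∀ k, μ.real ({ω | U a ω = i} ∩ {ω | ∀ k, U (a + k + 1) ω ≠ j}) ≤
        μ.real {ω | U a ω = i} * (1 - δ ^ 2) ^ k := by
      intro k
      have h0 : {ω | U a ω = i} ∩ {ω | ∀ k, U (a + k + 1) ω ≠ j} ⊆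
          {ω | U a ω = i} ∩ {ω | ∀ t < 2 * k, U (a + t + 1) ω ≠ j} :=
        fun ω hω => ⟨hω.1, fun t _ => hω.2 t⟩
      refine (measureReal_mono h0).trans
        ((h.measureReal_avoid hR hη (measurableSet_state_eq_history le_rfl i) (fun _ hω => hω) j
          (2 * k)).trans_le (mul_le_mul_of_nonneg_left ?_ measureReal_nonneg))
      refine (avoiding_pow_mulVec_one_le (r := ⟨R, hRmem⟩) ?_ ?_ hδ.le ?_ ?_ k i).2
      · intro i l
        rw [weightMatrix_one_apply]
        exact ENNReal.toReal_nonneg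
      · intro i
        simp_rw [weightMatrix_one_apply]
        exact (sum_stepProb_toReal i).le
      · intro i
        rw [weightMatrix_one_apply]
        exact inv_le_stepProb_toReal_of_right i.2
      · rw [weightMatrix_one_apply]
        exact (stepProb_toReal_of_left j.2).ge
    have h2 := (tendsto_pow_atTop_nhds_zero_of_lt_one (r := 1 - δ ^ 2) (by nlinarith)
      (by nlinarith)).const_mul (μ.real {ω | U a ω = i})
    rw [mul_zero] at h2
    exact le_antisymm (ge_of_tendsto' h2 h1) measureReal_nonneg
  have h3 : ∀ i : Finset.Icc 1 R, ∀ᵐ ω ∂μ, U a ω = i → ∃ k, U (a + k + 1) ω = j := by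
    intro i
    refine (measure_eq_zero_iff_ae_notMem.1 ((measureReal_eq_zero_iff).1 (key i))).mono
      fun ω hω hi => ?_
    by_contra! hcon
    exact hω ⟨hi, hcon⟩
  filter_upwards [ae_all_iff.2 h3, h.ae_state_mem hR] with ω h4 h5
  exact h4 ⟨U a ω, h5 a⟩ rfl

end IsTrickleProcess

theorem integrable_and_hasSum_integral {Ω ι E : Type*} [MeasurableSpace Ω] {μ : Measure Ω}
    [Countable ι] [NormedAddCommGroup E] [NormedSpace ℝ E] {F : ι → Ω → E} {f : Ω → E}
    (hF : ∀ i, Integrable (F i) μ) (hsum : Summable fun i => ∫ ω, ‖F i ω‖ ∂μ)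
    (hf : ∀ᵐ ω ∂μ, HasSum (F · ω) (f ω)) :
    Integrable f μ ∧ HasSum (fun i => ∫ ω, F i ω ∂μ) (∫ ω, f ω ∂μ) := by
  have hmeas : AEStronglyMeasurable f μ :=
    aestronglyMeasurable_of_tendsto_ae Filter.atTop (f := fun (s : Finset ι) ω => ∑ i ∈ s, F i ω)
      (fun s => (integrable_finsetSum s fun i _ => hF i).aestronglyMeasurable) hf
  have hfin : ∑' i, ∫⁻ ω, ‖F i ω‖ₑ ∂μ ≠ ∞ := by
    have h1 : ∀ i, ∫⁻ ω, ‖F i ω‖ₑ ∂μ = ENNReal.ofReal (∫ ω, ‖F i ω‖ ∂μ) := fun i =>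
      (ofReal_integral_norm_eq_lintegral_enorm (hF i)).symm
    simp_rw [h1]
    exact hsum.tsum_ofReal_ne_top
  refine ⟨⟨hmeas, lt_of_le_of_lt ?_ hfin.lt_top⟩, ?_⟩
  · rw [← lintegral_tsum fun i => (hF i).aestronglyMeasurable.enorm]
    refine lintegral_mono_ae (hf.mono fun ω hω => ?_)
    rw [← hω.tsum_eq]
    exact enorm_tsum_le_tsum_enorm
  · have h1 := hasSum_integral_of_summable_integral_norm hF hsum
    rwa [integral_congr_ae (hf.mono fun ω hω => hω.tsum_eq)] at h1

/-! ### Passages between states, decomposed by entry index and duration -/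

section Paths

variable {Ω : Type*} {U : ℕ → Ω → ℕ} {θ : ℕ → Ω → ℝ}

theorem updatedNodes_zero (U : ℕ → Ω → ℕ) (ω : Ω) : updatedNodes U 0 ω = 0 := by
  simp [updatedNodes]

theorem updatedNodes_succ (U : ℕ → Ω → ℕ) (m : ℕ) (ω : Ω) :
    updatedNodes U (m + 1) ω = updatedNodes U m ω + U (m + 1) ω :=
  Finset.sum_Icc_succ_top (by omega) _

theorem transmissionTime_zero (θ : ℕ → Ω → ℝ) (ω : Ω) : transmissionTime θ 0 ω = 0 := by
  simp [transmissionTime]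

theorem transmissionTime_succ (θ : ℕ → Ω → ℝ) (m : ℕ) (ω : Ω) :
    transmissionTime θ (m + 1) ω = transmissionTime θ m ω + θ (m + 1) ω :=
  Finset.sum_Icc_succ_top (by omega) _

theorem updatedNodes_add (U : ℕ → Ω → ℕ) (a k : ℕ) (ω : Ω) :
    updatedNodes U (a + k) ω = updatedNodes U a ω + ∑ t ∈ Finset.range k, U (a + t + 1) ω := by
  induction k with
  | zero => simp
  | succ k ih => rw [← add_assoc, updatedNodes_succ, ih, Finset.sum_range_succ, add_assoc]

theorem transmissionTime_add (θ : ℕ → Ω → ℝ) (a k : ℕ) (ω : Ω) :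
    transmissionTime θ (a + k) ω =
      transmissionTime θ a ω + ∑ t ∈ Finset.range k, θ (a + t + 1) ω := by
  induction k with
  | zero => simp
  | succ k ih => rw [← add_assoc, transmissionTime_succ, ih, Finset.sum_range_succ, add_assoc]

/-- Positive sojourn times make `transmissionTime` strictly increasing, so the last transmission up
to time T_m is number m itself. -/
theorem updatedNodesAt_transmissionTime {ω : Ω} (hθ : ∀ m, 0 < θ (m + 1) ω) (m : ℕ) :
    updatedNodesAt U θ (transmissionTime θ m ω) ω = updatedNodes U m ω := by
  have hmono : StrictMono fun m => transmissionTime θ m ω := strictMono_nat_of_lt_succ fun m => by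
    rw [transmissionTime_succ]
    exact lt_add_of_pos_right _ (hθ m)
  have h1 : {k | transmissionTime θ k ω ≤ transmissionTime θ m ω} = Set.Iic m :=
    Set.ext fun k => hmono.le_iff_le
  rw [updatedNodesAt, h1, csSup_Iic]

theorem pathWeight_pow_exp (z s : ℂ) (U : ℕ → Ω → ℕ) (θ : ℕ → Ω → ℝ) (a k : ℕ) (ω : Ω) :
    pathWeight U θ (fun x : ℝ => Complex.exp (s * x)) (fun l => z ^ l) a k ω =
      z ^ (updatedNodes U (a + k) ω - updatedNodes U a ω) *
        Complex.exp (s * (transmissionTime θ (a + k) ω - transmissionTime θ a ω : ℝ)) := by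
  rw [updatedNodes_add, transmissionTime_add, Nat.add_sub_cancel_left, add_sub_cancel_left,
    pathWeight, Finset.prod_mul_distrib,
    Finset.prod_pow_eq_pow_sum, ← Complex.exp_sum, Complex.ofReal_sum, Finset.mul_sum]

/-- The event that the chain enters the state `i` for the first time at index `a`. -/
def entryEvent (U : ℕ → Ω → ℕ) (i a : ℕ) : Set Ω :=
  {ω | U a ω = i ∧ ∀ b < a, U b ω ≠ i}

theorem firstEntry_eq {i a : ℕ} {ω : Ω} (h : ω ∈ entryEvent U i a) : firstEntry U i ω = a :=
  le_antisymm (Nat.sInf_le h.1) (le_csInf ⟨a, h.1⟩ fun b hb => not_lt.1 fun hba => h.2 b hba hb)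

theorem mem_entryEvent_firstEntry {i : ℕ} {ω : Ω} (h : ∃ m, U m ω = i) :
    ω ∈ entryEvent U i (firstEntry U i ω) :=
  ⟨Nat.sInf_mem (s := {m | U m ω = i}) h, fun _ hb =>
    Nat.notMem_of_lt_sInf (s := {m | U m ω = i}) hb⟩

theorem exists_passageSteps_eq {i j : ℕ} {ω : Ω}
    (h : ∃ k, U (firstEntry U i ω + k + 1) ω = j) :
    ∃ k, passageSteps U i j ω = k + 1 ∧ U (firstEntry U i ω + k + 1) ω = j ∧
      ∀ t < k, U (firstEntry U i ω + t + 1) ω ≠ j := by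
  obtain ⟨k, hk⟩ := h
  have h1 : 1 ≤ passageSteps U i j ω ∧ U (firstEntry U i ω + passageSteps U i j ω) ω = j :=
    Nat.sInf_mem (s := {k | 1 ≤ k ∧ U (firstEntry U i ω + k) ω = j}) ⟨k + 1, by omega, hk⟩
  refine ⟨passageSteps U i j ω - 1, by omega, ?_, fun t ht hcon => ?_⟩
  · rw [add_assoc, Nat.sub_add_cancel h1.1]
    exact h1.2
  · have h2 : t + 1 < passageSteps U i j ω := by omega
    exact Nat.notMem_of_lt_sInf h2 ⟨by omega, hcon⟩

theorem measurableSet_entryEvent_history (i a : ℕ) :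
    MeasurableSet[history U θ a] (entryEvent U i a) := by
  have h1 : entryEvent U i a = {ω | U a ω = i} ∩ ⋂ b, ⋂ (_ : b < a), {ω | U b ω = i}ᶜ := by
    ext ω; simp [entryEvent]
  rw [h1]
  refine MeasurableSet.inter (measurableSet_state_eq_history le_rfl i)
    (MeasurableSet.iInter fun b => MeasurableSet.iInter fun hb => ?_)
  exact (measurableSet_state_eq_history hb.le i).compl

/-- The weight of the passage from `i` to `j` if `i` is entered at index `a` and the passage takes
`k + 1` transitions, and `0` otherwise. -/
noncomputable def passageTerm {𝕜 : Type*} [CommSemiring 𝕜] (U : ℕ → Ω → ℕ) (θ : ℕ → Ω → ℝ)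
    (g : ℝ → 𝕜) (c : ℕ → 𝕜) (i j a k : ℕ) : Ω → 𝕜 :=
  {ω | U (a + k + 1) ω = j}.indicator fun ω =>
    (entryEvent U i a).indicator (pathWeight U θ g (fun l => if l = j then 0 else c l) a k) ω *
      (c (U (a + k + 1) ω) * g (θ (a + k + 1) ω))

theorem norm_passageTerm {𝕜 : Type*} [RCLike 𝕜] (g : ℝ → 𝕜) (c : ℕ → 𝕜) (i j a k : ℕ) (ω : Ω) :
    ‖passageTerm U θ g c i j a k ω‖ =
      passageTerm U θ (fun x => ‖g x‖) (fun l => ‖c l‖) i j a k ω := by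
  rw [passageTerm, passageTerm, norm_indicator_eq_indicator_norm]
  congr 1
  ext ω
  rw [norm_mul, norm_indicator_eq_indicator_norm, norm_mul]
  congr 2
  ext ω
  rw [pathWeight, norm_prod]
  refine Finset.prod_congr rfl fun t _ => ?_
  by_cases hj : U (a + t + 1) ω = j <;> simp [hj]

theorem hasSum_passageTerm {𝕜 : Type*} [RCLike 𝕜] (g : ℝ → 𝕜) (c : ℕ → 𝕜) {i j : ℕ} {ω : Ω}
    (hi : ∃ m, U m ω = i) (hj : ∃ k, U (firstEntry U i ω + k + 1) ω = j) :
    HasSum (fun p : ℕ × ℕ => passageTerm U θ g c i j p.1 p.2 ω)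
      (pathWeight U θ g c (firstEntry U i ω) (passageSteps U i j ω) ω) := by
  obtain ⟨k, hk, hkj, hlt⟩ := exists_passageSteps_eq hj
  have hE := mem_entryEvent_firstEntry hi
  rw [hk]
  set a := firstEntry U i ω
  have hval : passageTerm U θ g c i j a k ω = pathWeight U θ g c a (k + 1) ω := by
    have h1 : ω ∈ {ω | U (a + k + 1) ω = j} := hkj
    have h2 : ω ∈ {ω | ∀ t < k, U (a + t + 1) ω ≠ j} := hlt
    rw [passageTerm, Set.indicator_of_mem h1, Set.indicator_of_mem hE, pathWeight_avoiding,
      Set.indicator_of_mem h2, pathWeight, pathWeight, Finset.prod_range_succ]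
  rw [← hval]
  refine hasSum_single (a, k) fun p hp => ?_
  by_cases h1 : ω ∈ {ω | U (p.1 + p.2 + 1) ω = j}
  · rw [passageTerm, Set.indicator_of_mem h1]
    by_cases h2 : ω ∈ entryEvent U i p.1
    · have h3 : p.1 = a := (firstEntry_eq h2).symm
      have h4 : ω ∉ {ω | ∀ t < p.2, U (p.1 + t + 1) ω ≠ j} := by
        intro h5
        -- A shorter passage contradicts that `k` is the first hit, an equal one is the excluded
        -- pair, and a longer one fails to avoid `j` at step `k`.
        rcases lt_trichotomy p.2 k with h6 | h6 | h6
        · exact hlt p.2 h6 (h3 ▸ h1)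
        · exact hp (Prod.ext h3 h6)
        · exact h5 k h6 (h3.symm ▸ hkj)
      rw [Set.indicator_of_mem h2, pathWeight_avoiding, Set.indicator_of_notMem h4, zero_mul]
    · rw [Set.indicator_of_notMem h2, zero_mul]
  · rw [passageTerm, Set.indicator_of_notMem h1]

end Paths

namespace IsTrickleProcess

variable {Ω : Type*} [MeasurableSpace Ω] {R : ℕ} {η : ℝ} {μ : Measure Ω}
  {U : ℕ → Ω → ℕ} {θ : ℕ → Ω → ℝ} {𝕜 : Type*} [RCLike 𝕜]

theorem integrable_passageTerm [IsFiniteMeasure μ] (h : IsTrickleProcess R η μ U θ)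
    (hR : 1 ≤ R) (hη : η ∈ Set.Icc (0 : ℝ) 1) {g : ℝ → 𝕜} (hg : Continuous g) (c : ℕ → 𝕜)
    (i j a k : ℕ) : Integrable (passageTerm U θ g c i j a k) μ := by
  refine Integrable.indicator ?_ (h.measurableSet_state_eq _ _)
  refine h.integrable_mul_factor hR hη ?_ hg c (a + k)
  exact (h.integrable_pathWeight hR hη hg _ a k).indicator
    (h.history_le a _ (measurableSet_entryEvent_history i a))

theorem integral_passageTerm [IsFiniteMeasure μ] (h : IsTrickleProcess R η μ U θ)
    (hR : 1 ≤ R) (hη : η ∈ Set.Icc (0 : ℝ) 1) {g : ℝ → 𝕜} (hg : Continuous g) (c : ℕ → 𝕜)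
    (i j : Finset.Icc 1 R) (a k : ℕ) :
    ∫ ω, passageTerm U θ g c i j a k ω ∂μ =
      (μ.real (entryEvent U i a) : 𝕜) * firstPassage (weightMatrix R η g c) i j k := by
  rw [← h.setIntegral_firstPassage hR hη hg c (measurableSet_entryEvent_history (i : ℕ) a)
    (fun ω hω => hω.1) k j]
  exact integral_indicator (h.measurableSet_state_eq _ _)

/-- The first entry index is unique, so the events are disjoint; they exhaust the space up to a null
set because `i` is almost surely reached. -/
theorem hasSum_measureReal_entryEvent [IsProbabilityMeasure μ] (h : IsTrickleProcess R η μ U θ)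
    (hR : 1 ≤ R) (hη : η ∈ Set.Icc (0 : ℝ) 1) (i : Finset.Icc 1 R) :
    HasSum (fun a => μ.real (entryEvent U i a)) 1 := by
  have hmeas : ∀ a, MeasurableSet (entryEvent U i a) := fun a =>
    h.history_le a _ (measurableSet_entryEvent_history i a)
  have hdisj : Pairwise (Function.onFun Disjoint (entryEvent U i)) := fun a b hab =>
    Set.disjoint_left.2 fun ω ha hb => hab ((firstEntry_eq ha).symm.trans (firstEntry_eq hb))
  have hall : μ (⋃ a, entryEvent U i a) = 1 := by
    rw [← measure_univ (μ := μ)]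
    refine measure_congr ?_
    filter_upwards [h.ae_exists_state_eq hR hη i] with ω hω
    obtain ⟨k, hk⟩ := hω 0
    exact propext ⟨fun _ => trivial, fun _ =>
      Set.mem_iUnion.2 ⟨_, mem_entryEvent_firstEntry ⟨_, hk⟩⟩⟩
  rw [measure_iUnion hdisj hmeas] at hall
  have h1 := ENNReal.hasSum_toReal (f := fun a => μ (entryEvent U i a)) (by rw [hall]; simp)
  rwa [← ENNReal.tsum_toReal_eq fun a => measure_ne_top _ _, hall, ENNReal.toReal_one] at h1

/-- The expected weight of the passage from `i` to `j`. -/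
theorem integrable_and_integral_passage [IsProbabilityMeasure μ] (h : IsTrickleProcess R η μ U θ)
    (hR : 1 ≤ R) (hη : η ∈ Set.Icc (0 : ℝ) 1) {g : ℝ → 𝕜} (hg : Continuous g) (c : ℕ → 𝕜)
    (i j : Finset.Icc 1 R)
    (hsum : Summable (firstPassage (weightMatrix R η (fun x => ‖g x‖) fun l => ‖c l‖) i j)) :
    Integrable (fun ω => pathWeight U θ g c (firstEntry U i ω) (passageSteps U i j ω) ω) μ ∧
      ∫ ω, pathWeight U θ g c (firstEntry U i ω) (passageSteps U i j ω) ω ∂μ =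
        ∑' k, firstPassage (weightMatrix R η g c) i j k := by
  have hentry := h.hasSum_measureReal_entryEvent hR hη i
  have hint : ∀ p : ℕ × ℕ, Integrable (passageTerm U θ g c i j p.1 p.2) μ := fun p =>
    h.integrable_passageTerm hR hη hg c i j p.1 p.2
  have hnorm : Summable fun p : ℕ × ℕ => ∫ ω, ‖passageTerm U θ g c i j p.1 p.2 ω‖ ∂μ := by
    simp_rw [norm_passageTerm, h.integral_passageTerm hR hη hg.norm]
    have hpos : ∀ k, 0 ≤ firstPassage (weightMatrix R η (fun x => ‖g x‖) fun l => ‖c l‖) i j k :=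
      fun k => (norm_nonneg _).trans
        (norm_firstPassage_le_firstPassage (norm_weightMatrix_le R η g c) i j k)
    have h1 := hentry.summable.mul_of_nonneg hsum (fun _ => measureReal_nonneg) hpos
    exact h1
  have hae : ∀ᵐ ω ∂μ, HasSum (fun p : ℕ × ℕ => passageTerm U θ g c i j p.1 p.2 ω)
      (pathWeight U θ g c (firstEntry U i ω) (passageSteps U i j ω) ω) := by
    filter_upwards [h.ae_exists_state_eq hR hη i, h.ae_exists_state_eq hR hη j] with ω h1 h2
    exact hasSum_passageTerm g c ⟨_, (h1 0).choose_spec⟩ (h2 _)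
  obtain ⟨h1, h2⟩ := integrable_and_hasSum_integral hint hnorm hae
  refine ⟨h1, h2.unique ?_⟩
  simp_rw [h.integral_passageTerm hR hη hg]
  have h3 : HasSum (fun a => (μ.real (entryEvent U i a) : 𝕜)) 1 := by
    simpa only [RCLike.ofReal_one] using (RCLike.hasSum_ofReal 𝕜).2 hentry
  have h4 : Summable fun k => ‖firstPassage (weightMatrix R η g c) i j k‖ :=
    Summable.of_nonneg_of_le (fun _ => norm_nonneg _)
      (norm_firstPassage_le_firstPassage (norm_weightMatrix_le R η g c) i j) hsum
  have h6 : Summable fun a => ‖(μ.real (entryEvent U i a) : 𝕜)‖ := by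
    simp_rw [RCLike.norm_ofReal, abs_of_nonneg measureReal_nonneg]
    exact hentry.summable
  have h7 := summable_mul_of_summable_norm h6 h4
  have h5 := h3.mul h4.of_norm.hasSum h7
  rw [one_mul] at h5
  exact h5
end IsTrickleProcess

/-! ### Decomposition of the delay transform by hop count -/

section Delay

variable {Ω : Type*} {U : ℕ → Ω → ℕ} {θ : ℕ → Ω → ℝ}

/-- The event that the hop count for `n` nodes is `m`. -/
def hopEvent (U : ℕ → Ω → ℕ) (n m : ℕ) : Set Ω :=
  {ω | n ≤ updatedNodes U m ω ∧ ∀ k < m, updatedNodes U k ω < n}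

theorem hopCount_eq {n m : ℕ} {ω : Ω} (h : ω ∈ hopEvent U n m) : hopCount U n ω = m :=
  le_antisymm (Nat.sInf_le h.1)
    (le_csInf ⟨m, h.1⟩ fun k hk => not_lt.1 fun hkm => (h.2 k hkm).not_ge hk)

theorem mem_hopEvent_hopCount {n : ℕ} {ω : Ω} (h : ∃ m, n ≤ updatedNodes U m ω) :
    ω ∈ hopEvent U n (hopCount U n ω) :=
  ⟨Nat.sInf_mem (s := {m | n ≤ updatedNodes U m ω}) h, fun _ hk => not_le.1
    (Nat.notMem_of_lt_sInf (s := {m | n ≤ updatedNodes U m ω}) hk)⟩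

theorem le_updatedNodes {ω : Ω} (hU : ∀ m, 1 ≤ U m ω) (m : ℕ) : m ≤ updatedNodes U m ω := by
  induction m with
  | zero => exact Nat.zero_le _
  | succ m ih =>
    rw [updatedNodes_succ]
    exact add_le_add ih (hU _)

theorem updatedNodes_le {R : ℕ} {ω : Ω} (hU : ∀ m, U m ω ≤ R) (m : ℕ) :
    updatedNodes U m ω ≤ R * m := by
  induction m with
  | zero => simp [updatedNodes_zero]
  | succ m ih =>
    rw [updatedNodes_succ, mul_add, mul_one]
    exact add_le_add ih (hU _)

theorem hopCount_le {ω : Ω} (hU : ∀ m, 1 ≤ U m ω) (n : ℕ) : hopCount U n ω ≤ n :=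
  Nat.sInf_le (le_updatedNodes hU n)

theorem mem_hopEvent_succ_iff {ω : Ω} {n m : ℕ} :
    ω ∈ hopEvent U n (m + 1) ↔ n ∈ Finset.Ioc (updatedNodes U m ω) (updatedNodes U (m + 1) ω) := by
  have hmono : Monotone fun m => updatedNodes U m ω := monotone_nat_of_le_succ fun m => by
    rw [updatedNodes_succ]
    exact Nat.le_add_right _ _
  rw [Finset.mem_Ioc]
  exact ⟨fun h => ⟨h.2 m (Nat.lt_succ_self m), h.1⟩,
    fun h => ⟨h.2, fun k hk => (hmono (Nat.le_of_lt_succ hk)).trans_lt h.1⟩⟩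

theorem pathWeight_pow {𝕜 : Type*} [CommMonoid 𝕜] (g : ℝ → 𝕜) (z : 𝕜) (m : ℕ) (ω : Ω) :
    pathWeight U θ g (fun l => z ^ l) 0 m ω =
      pathWeight U θ g (fun _ => 1) 0 m ω * z ^ updatedNodes U m ω := by
  have h1 := updatedNodes_add U 0 m ω
  rw [zero_add, updatedNodes_zero, zero_add] at h1
  simp_rw [pathWeight, one_mul]
  rw [Finset.prod_mul_distrib, h1, Finset.prod_pow_eq_pow_sum, mul_comm]

theorem pathWeight_succ {𝕜 : Type*} [CommMonoid 𝕜] (g : ℝ → 𝕜) (c : ℕ → 𝕜) (m : ℕ) (ω : Ω) :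
    pathWeight U θ g c 0 (m + 1) ω =
      pathWeight U θ g c 0 m ω * (c (U (m + 1) ω) * g (θ (m + 1) ω)) := by
  simp only [pathWeight, Finset.prod_range_succ, zero_add]

/-- The contribution of the hop count `m` to the `n`-th term of the delay transform. -/
noncomputable def delayTerm {𝕜 : Type*} [CommSemiring 𝕜] (U : ℕ → Ω → ℕ) (θ : ℕ → Ω → ℝ)
    (g : ℝ → 𝕜) (z : 𝕜) (n m : ℕ) (ω : Ω) : 𝕜 :=
  (hopEvent U n m).indicator (pathWeight U θ g (fun _ => 1) 0 m) ω * z ^ n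

variable {𝕜 : Type*} [RCLike 𝕜]

theorem norm_delayTerm (g : ℝ → 𝕜) (z : 𝕜) (n m : ℕ) (ω : Ω) :
    ‖delayTerm U θ g z n m ω‖ = delayTerm U θ (fun x => ‖g x‖) ‖z‖ n m ω := by
  have h1 : (fun ω => ‖pathWeight U θ g (fun _ => 1) 0 m ω‖) =
      pathWeight U θ (fun x => ‖g x‖) (fun _ => 1) 0 m := by
    ext ω
    simp [pathWeight]
  rw [delayTerm, delayTerm, norm_mul, norm_pow, norm_indicator_eq_indicator_norm, h1]

theorem delayTerm_eq_zero (g : ℝ → 𝕜) (z : 𝕜) {n m : ℕ} {ω : Ω} (h : hopCount U n ω ≠ m) :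
    delayTerm U θ g z n m ω = 0 := by
  rw [delayTerm, Set.indicator_of_notMem fun h1 => h (hopCount_eq h1), zero_mul]

theorem hasSum_delayTerm (g : ℝ → 𝕜) (z : 𝕜) {n : ℕ} {ω : Ω}
    (h : ∃ m, n ≤ updatedNodes U m ω) :
    HasSum (fun m => delayTerm U θ g z n m ω)
      (pathWeight U θ g (fun _ => 1) 0 (hopCount U n ω) ω * z ^ n) := by
  have h1 : delayTerm U θ g z n (hopCount U n ω) ω =
      pathWeight U θ g (fun _ => 1) 0 (hopCount U n ω) ω * z ^ n := by
    rw [delayTerm, Set.indicator_of_mem (mem_hopEvent_hopCount h)]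
  rw [← h1]
  exact hasSum_single _ fun m hm => delayTerm_eq_zero g z hm.symm

theorem delayTerm_zero_right (g : ℝ → 𝕜) (z : 𝕜) (n : ℕ) (ω : Ω) :
    delayTerm U θ g z n 0 ω = if n = 0 then 1 else 0 := by
  have h1 : ω ∈ hopEvent U n 0 ↔ n = 0 := by simp [hopEvent, updatedNodes_zero]
  by_cases hn : n = 0
  · rw [delayTerm, Set.indicator_of_mem (h1.2 hn)]
    simp [hn, pathWeight]
  · rw [delayTerm, Set.indicator_of_notMem (mt h1.1 hn), zero_mul, if_neg hn]

theorem sum_delayTerm_succ (g : ℝ → 𝕜) (z : 𝕜) {m N : ℕ} {ω : Ω}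
    (hN : updatedNodes U (m + 1) ω < N) :
    ∑ n ∈ Finset.range N, delayTerm U θ g z n (m + 1) ω =
      pathWeight U θ g (fun _ => 1) 0 (m + 1) ω *
        ∑ n ∈ Finset.Ioc (updatedNodes U m ω) (updatedNodes U (m + 1) ω), z ^ n := by
  have h1 : Finset.Ioc (updatedNodes U m ω) (updatedNodes U (m + 1) ω) ⊆ Finset.range N :=
    fun n hn => Finset.mem_range.2 ((Finset.mem_Ioc.1 hn).2.trans_lt hN)
  rw [Finset.mul_sum, ← Finset.sum_subset h1]
  · refine Finset.sum_congr rfl fun n hn => ?_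
    rw [delayTerm, Set.indicator_of_mem (mem_hopEvent_succ_iff.2 hn)]
  · intro n _ hn
    rw [delayTerm, Set.indicator_of_notMem (mt mem_hopEvent_succ_iff.1 hn), zero_mul]

/-- All n in one block share the same delay, and the geometric sum over the block telescopes. At the
lower end the state weights stop at m while the time weights run to m + 1, hence the extra factor `g
(θ (m + 1) ω)`. -/
theorem one_sub_mul_sum_delayTerm_succ (g : ℝ → 𝕜) (z : 𝕜) {m N : ℕ} {ω : Ω}
    (hN : updatedNodes U (m + 1) ω < N) :
    (1 - z) * ∑ n ∈ Finset.range N, delayTerm U θ g z n (m + 1) ω =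
      z * (pathWeight U θ g (fun l => z ^ l) 0 m ω * g (θ (m + 1) ω) -
        pathWeight U θ g (fun l => z ^ l) 0 (m + 1) ω) := by
  have h1 : ∀ a b : ℕ, a ≤ b →
      (1 - z) * ∑ n ∈ Finset.Ioc a b, z ^ n = z * (z ^ a - z ^ b) := by
    intro a b hab
    induction b, hab using Nat.le_induction with
    | base => simp
    | succ b hab ih =>
      rw [Finset.sum_Ioc_succ_top hab, mul_add, ih]
      ring
  have h2 : updatedNodes U m ω ≤ updatedNodes U (m + 1) ω := by
    rw [updatedNodes_succ]
    exact Nat.le_add_right _ _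
  rw [sum_delayTerm_succ g z hN, mul_left_comm, h1 _ _ h2, pathWeight_pow, pathWeight_pow,
    pathWeight_succ]
  ring

/-- Only the top index n = A(m+1) of the block is kept; it belongs to the block because at least one
node is added. -/
theorem pathWeight_le_sum_delayTerm_succ {g : ℝ → ℝ} (hg : ∀ x, 0 ≤ g x) {z : ℝ} (hz : 0 ≤ z)
    {m N : ℕ} {ω : Ω} (hU : 1 ≤ U (m + 1) ω) (hN : updatedNodes U (m + 1) ω < N) :
    pathWeight U θ g (fun l => z ^ l) 0 (m + 1) ω ≤
      ∑ n ∈ Finset.range N, delayTerm U θ g z n (m + 1) ω := by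
  rw [sum_delayTerm_succ g z hN, pathWeight_pow]
  refine mul_le_mul_of_nonneg_left ?_ (Finset.prod_nonneg fun t _ => by simpa using hg _)
  refine Finset.single_le_sum (f := fun n => z ^ n) (fun n _ => pow_nonneg hz n)
    (Finset.mem_Ioc.2 ⟨?_, le_rfl⟩)
  rw [updatedNodes_succ]
  omega

end Delay

namespace IsTrickleProcess

variable {Ω : Type*} [MeasurableSpace Ω] {R : ℕ} {η : ℝ} {μ : Measure Ω}
  {U : ℕ → Ω → ℕ} {θ : ℕ → Ω → ℝ} {𝕜 : Type*} [RCLike 𝕜]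

theorem setIntegral_pathWeight [IsProbabilityMeasure μ] (h : IsTrickleProcess R η μ U θ)
    (hR : 1 ≤ R) (hη : η ∈ Set.Icc (0 : ℝ) 1) {g : ℝ → 𝕜} (hg : Continuous g) (c : ℕ → 𝕜)
    (i : Finset.Icc 1 R) (hi : (i : ℕ) = 1) (m : ℕ) (l : Finset.Icc 1 R) :
    ∫ ω in {ω | U m ω = l}, pathWeight U θ g c 0 m ω ∂μ = (weightMatrix R η g c ^ m) i l := by
  have h1 := h.setIntegral_indicator_pathWeight hR hη hg c
    (measurableSet_state_eq_history (m := 0) le_rfl i) (fun ω hω => hω) m l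
  have h2 : ∀ᵐ ω ∂μ, ω ∈ {ω | U 0 ω = i} := by
    filter_upwards [h.initial] with ω hω
    exact hω.trans hi.symm
  have h3 : μ.real {ω | U 0 ω = i} = 1 := by
    rw [measureReal_def, prob_compl_eq_zero_iff (h.measurableSet_state_eq _ _) |>.1 h2,
      ENNReal.toReal_one]
  rw [h3, RCLike.ofReal_one, one_mul] at h1
  rw [← h1, zero_add]
  refine integral_congr_ae (ae_restrict_of_ae ?_)
  exact h2.mono fun ω hω => (Set.indicator_of_mem hω _).symm

theorem integral_pathWeight [IsProbabilityMeasure μ] (h : IsTrickleProcess R η μ U θ)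
    (hR : 1 ≤ R) (hη : η ∈ Set.Icc (0 : ℝ) 1) {g : ℝ → 𝕜} (hg : Continuous g) (c : ℕ → 𝕜)
    (i : Finset.Icc 1 R) (hi : (i : ℕ) = 1) (m : ℕ) :
    ∫ ω, pathWeight U θ g c 0 m ω ∂μ = ∑ l, (weightMatrix R η g c ^ m) i l := by
  rw [← setIntegral_univ, ← h.sum_setIntegral_state hR MeasurableSet.univ
    (h.integrable_pathWeight hR hη hg c 0 m).integrableOn m]
  simp_rw [Set.inter_univ]
  exact Finset.sum_congr rfl fun l _ => h.setIntegral_pathWeight hR hη hg c i hi m l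

theorem sum_weightMatrix_one (R : ℕ) (η : ℝ) (g : ℝ → 𝕜) (i : Finset.Icc 1 R) :
    ∑ l, weightMatrix R η g (fun _ => 1) i l = ∫ x, g x ∂sojournLaw η i := by
  simp only [weightMatrix, Matrix.of_apply, mul_one]
  rw [← Finset.sum_mul, ← RCLike.ofReal_sum, sum_stepProb_toReal, RCLike.ofReal_one, one_mul]

/-- The last time factor is a transition with state weight 1; summing over its target removes the
transition probabilities. -/
theorem integral_pathWeight_mul_time [IsProbabilityMeasure μ] (h : IsTrickleProcess R η μ U θ)
    (hR : 1 ≤ R) (hη : η ∈ Set.Icc (0 : ℝ) 1) {g : ℝ → 𝕜} (hg : Continuous g) (c : ℕ → 𝕜)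
    (i : Finset.Icc 1 R) (hi : (i : ℕ) = 1) (m : ℕ) :
    ∫ ω, pathWeight U θ g c 0 m ω * g (θ (m + 1) ω) ∂μ =
      ∑ l, (weightMatrix R η g c ^ m) i l * ∫ x, g x ∂sojournLaw η l := by
  have hX := h.integrable_pathWeight hR hη hg c 0 m
  have hX' := h.integrable_mul_factor hR hη hX hg (fun _ => 1) m
  have hm := measurable_pathWeight_history (U := U) (θ := θ) hg c 0 m
  rw [zero_add] at hm
  simp_rw [one_mul] at hX'
  rw [← setIntegral_univ, ← h.sum_setIntegral_state hR MeasurableSet.univ hX'.integrableOn (m + 1)]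
  have h1 := fun l => h.setIntegral_mul_factor hR hη hm hX hg (fun _ => 1) l
  simp_rw [one_mul] at h1
  simp_rw [Set.inter_univ, h1, h.setIntegral_pathWeight hR hη hg c i hi]
  rw [Finset.sum_comm]
  simp_rw [← Finset.mul_sum, sum_weightMatrix_one]

theorem measurableSet_hopEvent (h : IsTrickleProcess R η μ U θ) (n m : ℕ) :
    MeasurableSet (hopEvent U n m) := by
  have hA : ∀ k, Measurable (updatedNodes U k) := fun k =>
    Finset.measurable_fun_sum _ fun i _ => h.measurable_state i
  have h1 : hopEvent U n m = updatedNodes U m ⁻¹' Set.Ici n ∩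
      ⋂ k, ⋂ (_ : k < m), updatedNodes U k ⁻¹' Set.Iio n := by
    ext ω; simp [hopEvent]
  rw [h1]
  exact (hA m measurableSet_Ici).inter
    (MeasurableSet.iInter fun k => MeasurableSet.iInter fun _ => hA k measurableSet_Iio)

theorem integrable_delayTerm [IsFiniteMeasure μ] (h : IsTrickleProcess R η μ U θ) (hR : 1 ≤ R)
    (hη : η ∈ Set.Icc (0 : ℝ) 1) {g : ℝ → 𝕜} (hg : Continuous g) (z : 𝕜) (n m : ℕ) :
    Integrable (delayTerm U θ g z n m) μ :=
  ((h.integrable_pathWeight hR hη hg _ 0 m).indicator (h.measurableSet_hopEvent n m)).mul_const _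

/-- Each hop adds between 1 and R nodes, so H⁽ⁿ⁾ ≤ n ≤ R H⁽ⁿ⁾: the double series in n and m is
finite in each variable separately. -/
theorem integral_delayTerm_eq_zero (h : IsTrickleProcess R η μ U θ) (hR : 1 ≤ R) (g : ℝ → 𝕜)
    (z : 𝕜) {n m : ℕ} (hnm : n < m ∨ R * m < n) : ∫ ω, delayTerm U θ g z n m ω ∂μ = 0 := by
  refine integral_eq_zero_of_ae ?_
  filter_upwards [h.ae_state_mem hR] with ω hω
  have h1 := fun m => Finset.mem_Icc.1 (hω m)
  rcases hnm with hnm | hnm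
  · exact delayTerm_eq_zero g z ((hopCount_le (fun m => (h1 m).1) n).trans_lt hnm).ne
  · have h2 : ω ∉ hopEvent U n m := fun h3 =>
      (h3.1.trans (updatedNodes_le (fun m => (h1 m).2) m)).not_gt hnm
    rw [delayTerm, Set.indicator_of_notMem h2, zero_mul, Pi.zero_apply]

theorem integrable_and_hasSum_delayTerm [IsProbabilityMeasure μ] (h : IsTrickleProcess R η μ U θ)
    (hR : 1 ≤ R) (hη : η ∈ Set.Icc (0 : ℝ) 1) {g : ℝ → 𝕜} (hg : Continuous g) (z : 𝕜) (n : ℕ) :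
    Integrable (fun ω => pathWeight U θ g (fun _ => 1) 0 (hopCount U n ω) ω * z ^ n) μ ∧
      HasSum (fun m => ∫ ω, delayTerm U θ g z n m ω ∂μ)
        (∫ ω, pathWeight U θ g (fun _ => 1) 0 (hopCount U n ω) ω * z ^ n ∂μ) := by
  refine integrable_and_hasSum_integral (fun m => h.integrable_delayTerm hR hη hg z n m) ?_ ?_
  · simp_rw [norm_delayTerm]
    refine summable_of_ne_finset_zero (s := Finset.range (n + 1)) fun m hm => ?_
    exact h.integral_delayTerm_eq_zero hR _ _ (Or.inl (by simpa using hm))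
  · filter_upwards [h.ae_state_mem hR] with ω hω
    exact hasSum_delayTerm g z ⟨n, le_updatedNodes (fun m => (Finset.mem_Icc.1 (hω m)).1) n⟩

theorem hasSum_integral_delayTerm_zero [IsProbabilityMeasure μ] (g : ℝ → 𝕜) (z : 𝕜) :
    HasSum (fun n => ∫ ω, delayTerm U θ g z n 0 ω ∂μ) 1 := by
  have h1 : (1 : 𝕜) = ∫ ω, delayTerm U θ g z 0 0 ω ∂μ := by simp [delayTerm_zero_right]
  rw [h1]
  exact hasSum_single 0 fun n hn => by simp [delayTerm_zero_right, hn]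

theorem hasSum_integral_delayTerm_succ [IsFiniteMeasure μ] (h : IsTrickleProcess R η μ U θ)
    (hR : 1 ≤ R) (hη : η ∈ Set.Icc (0 : ℝ) 1) {g : ℝ → 𝕜} (hg : Continuous g) (z : 𝕜) (m : ℕ) :
    HasSum (fun n => ∫ ω, delayTerm U θ g z n (m + 1) ω ∂μ)
      (∫ ω, ∑ n ∈ Finset.range (R * (m + 1) + 1), delayTerm U θ g z n (m + 1) ω ∂μ) := by
  rw [integral_finsetSum _ fun n _ => h.integrable_delayTerm hR hη hg z n (m + 1)]
  refine hasSum_sum_of_ne_finset_zero fun n hn => ?_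
  exact h.integral_delayTerm_eq_zero hR _ _ (Or.inr (by simpa [Nat.lt_succ_iff] using hn))

theorem one_sub_mul_tsum_delayTerm_succ [IsProbabilityMeasure μ] (h : IsTrickleProcess R η μ U θ)
    (hR : 1 ≤ R) (hη : η ∈ Set.Icc (0 : ℝ) 1) {g : ℝ → 𝕜} (hg : Continuous g) (z : 𝕜)
    (i : Finset.Icc 1 R) (hi : (i : ℕ) = 1) (m : ℕ) :
    (1 - z) * ∑' n, ∫ ω, delayTerm U θ g z n (m + 1) ω ∂μ =
      z * (∑ l, (weightMatrix R η g (fun l => z ^ l) ^ m) i l * ∫ x, g x ∂sojournLaw η l -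
        ∑ l, (weightMatrix R η g (fun l => z ^ l) ^ (m + 1)) i l) := by
  have hX := h.integrable_pathWeight hR hη hg (fun l => z ^ l) 0 m
  have hX' := h.integrable_mul_factor hR hη hX hg (fun _ => 1) m
  simp_rw [one_mul] at hX'
  rw [(h.hasSum_integral_delayTerm_succ hR hη hg z m).tsum_eq, ← integral_const_mul,
    ← h.integral_pathWeight_mul_time hR hη hg _ i hi, ← h.integral_pathWeight hR hη hg _ i hi,
    ← integral_sub hX' (h.integrable_pathWeight hR hη hg _ 0 (m + 1)), ← integral_const_mul]
  refine integral_congr_ae ?_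
  filter_upwards [h.ae_state_mem hR] with ω hω
  exact one_sub_mul_sum_delayTerm_succ g z
    (Nat.lt_succ_of_le (updatedNodes_le (fun m => (Finset.mem_Icc.1 (hω m)).2) _))

theorem sum_pow_le_tsum_delayTerm_succ [IsProbabilityMeasure μ] (h : IsTrickleProcess R η μ U θ)
    (hR : 1 ≤ R) (hη : η ∈ Set.Icc (0 : ℝ) 1) {g : ℝ → ℝ} (hg : Continuous g)
    (hg0 : ∀ x, 0 ≤ g x) {z : ℝ} (hz : 0 ≤ z) (i : Finset.Icc 1 R) (hi : (i : ℕ) = 1) (m : ℕ) :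
    ∑ l, (weightMatrix R η g (fun l => z ^ l) ^ (m + 1)) i l ≤
      ∑' n, ∫ ω, delayTerm U θ g z n (m + 1) ω ∂μ := by
  rw [(h.hasSum_integral_delayTerm_succ hR hη hg z m).tsum_eq,
    ← h.integral_pathWeight hR hη hg _ i hi]
  refine integral_mono_ae (h.integrable_pathWeight hR hη hg _ 0 (m + 1))
    (integrable_finsetSum _ fun n _ => h.integrable_delayTerm hR hη hg z n (m + 1)) ?_
  filter_upwards [h.ae_state_mem hR] with ω hω
  exact pathWeight_le_sum_delayTerm_succ hg0 hz (Finset.mem_Icc.1 (hω _)).1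
    (Nat.lt_succ_of_le (updatedNodes_le (fun m => (Finset.mem_Icc.1 (hω m)).2) _))

end IsTrickleProcess

/-! ### Taylor coefficients and exponential weights -/

/-- The coefficients of a power series with positive radius of convergence are the Taylor
coefficients of its sum. -/
theorem coeff_eq_iteratedDeriv_tsum {a : ℕ → ℂ} {M : ℝ} (hM : 0 < M) (ha : ∀ n, ‖a n‖ ≤ M ^ n)
    (n : ℕ) : a n = 1 / (n.factorial : ℂ) * iteratedDeriv n (fun z => ∑' k, a k * z ^ k) 0 := by
  set p := FormalMultilinearSeries.ofScalars ℂ a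
  have hrad : 0 < p.radius := by
    refine lt_of_lt_of_le ?_ (p.le_radius_of_bound (r := (Real.toNNReal M)⁻¹) 1 fun n => ?_)
    · simpa using hM
    · rw [FormalMultilinearSeries.ofScalars_norm, NNReal.coe_inv, Real.coe_toNNReal _ hM.le,
        inv_pow, ← div_eq_mul_inv]
      exact div_le_one_of_le₀ (ha n) (by positivity)
  have hp : HasFPowerSeriesAt (fun z => ∑' k, a k * z ^ k) p 0 := by
    have h1 := (p.hasFPowerSeriesOnBall hrad).hasFPowerSeriesAt
    have h2 : p.sum = fun z => ∑' k, a k * z ^ k := by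
      ext z
      exact FormalMultilinearSeries.ofScalars_sum_eq a z
    rwa [h2] at h1
  have h3 := hp.eq_formalMultilinearSeries (AnalyticAt.hasFPowerSeriesAt ⟨p, hp⟩)
  have h4 := congrFun (FormalMultilinearSeries.ofScalars_series_injective ℂ ℂ h3) n
  rw [h4]
  ring

section Exponential

variable {Ω : Type*}

theorem pathWeight_cexp (s : ℂ) (U : ℕ → Ω → ℕ) (θ : ℕ → Ω → ℝ) (m : ℕ) (ω : Ω) :
    pathWeight U θ (fun x : ℝ => Complex.exp (s * x)) (fun _ => 1) 0 m ω =
      Complex.exp (s * transmissionTime θ m ω) := by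
  have h1 := transmissionTime_add θ 0 m ω
  rw [zero_add, transmissionTime_zero, zero_add] at h1
  simp_rw [pathWeight, one_mul]
  rw [h1, Complex.ofReal_sum, Finset.mul_sum, Complex.exp_sum]

theorem pathWeight_exp (σ : ℝ) (U : ℕ → Ω → ℕ) (θ : ℕ → Ω → ℝ) (m : ℕ) (ω : Ω) :
    pathWeight U θ (fun x : ℝ => Real.exp (σ * x)) (fun _ => 1) 0 m ω =
      Real.exp (σ * transmissionTime θ m ω) := by
  have h1 := transmissionTime_add θ 0 m ω
  rw [zero_add, transmissionTime_zero, zero_add] at h1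
  simp_rw [pathWeight, one_mul]
  rw [h1, Finset.mul_sum, Real.exp_sum]

theorem transmissionTime_mem_Icc {θ : ℕ → Ω → ℝ} {ω : Ω}
    (hθ : ∀ m, θ (m + 1) ω ∈ Set.Ioc (0 : ℝ) 1) (m : ℕ) :
    transmissionTime θ m ω ∈ Set.Icc (0 : ℝ) m := by
  induction m with
  | zero => simp [transmissionTime_zero]
  | succ m ih =>
    have h1 := hθ m
    rw [transmissionTime_succ, Nat.cast_succ]
    exact ⟨by linarith [ih.1, h1.1], by linarith [ih.2, h1.2]⟩

theorem norm_cexp_mul (s : ℂ) (x : ℝ) : ‖Complex.exp (s * x)‖ = Real.exp (s.re * x) := by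
  rw [Complex.norm_exp, Complex.re_mul_ofReal]

end Exponential

theorem norm_complexMGF_endToEndDelay_le {Ω : Type*} [MeasurableSpace Ω] (μ : Measure Ω)
    (U : ℕ → Ω → ℕ) (θ : ℕ → Ω → ℝ) (s : ℂ) (n : ℕ) :
    ‖complexMGF (endToEndDelay U θ n) μ s‖ ≤ mgf (endToEndDelay U θ n) μ s.re := by
  refine (norm_integral_le_integral_norm _).trans_eq ?_
  simp_rw [norm_cexp_mul]
  rfl

/-! ### Convergence and the closed form -/

namespace IsTrickleProcess

variable {Ω : Type*} [MeasurableSpace Ω] {R : ℕ} {η : ℝ} {μ : Measure Ω}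
  {U : ℕ → Ω → ℕ} {θ : ℕ → Ω → ℝ} {𝕜 : Type*} [RCLike 𝕜]

theorem summable_integral_norm_delayTerm [IsProbabilityMeasure μ] (h : IsTrickleProcess R η μ U θ)
    (hR : 1 ≤ R) (hη : η ∈ Set.Icc (0 : ℝ) 1) {g : ℝ → ℝ} (hg : Continuous g)
    (hg0 : ∀ x, 0 ≤ g x) {z : ℝ} (hz : 0 ≤ z)
    (hs : Summable fun n =>
      ∫ ω, pathWeight U θ g (fun _ => 1) 0 (hopCount U n ω) ω * z ^ n ∂μ) :
    Summable fun p : ℕ × ℕ => ∫ ω, delayTerm U θ g z p.1 p.2 ω ∂μ := by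
  refine (summable_prod_of_nonneg fun p => integral_nonneg fun ω => ?_).2
    ⟨fun n => (h.integrable_and_hasSum_delayTerm hR hη hg z n).2.summable, ?_⟩
  · refine mul_nonneg (Set.indicator_nonneg (fun ω _ => ?_) ω) (pow_nonneg hz _)
    exact Finset.prod_nonneg fun t _ => by simpa using hg0 _
  · simpa only [(h.integrable_and_hasSum_delayTerm hR hη hg z _).2.tsum_eq] using hs

theorem weightMatrix_nonneg {g : ℝ → ℝ} (hg0 : ∀ x, 0 ≤ g x) {c : ℕ → ℝ} (hc : ∀ l, 0 ≤ c l)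
    (i l : Finset.Icc 1 R) : 0 ≤ weightMatrix R η g c i l :=
  mul_nonneg (mul_nonneg ENNReal.toReal_nonneg (integral_nonneg hg0)) (hc l)

theorem pow_apply_nonneg {ι : Type*} [Fintype ι] [DecidableEq ι] {B : Matrix ι ι ℝ}
    (hB : ∀ i j, 0 ≤ B i j) (m : ℕ) (i j : ι) : 0 ≤ (B ^ m) i j :=
  (norm_nonneg _).trans
    (norm_pow_apply_le (fun i j => (Real.norm_of_nonneg (hB i j)).le) m i j)

/-- All terms are nonnegative, so the double series may be summed by hop count first; each block sum
then dominates the corresponding row sum of the matrix power. -/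
theorem summable_weightMatrix_pow [IsProbabilityMeasure μ] (h : IsTrickleProcess R η μ U θ)
    (hR : 1 ≤ R) (hη : η ∈ Set.Icc (0 : ℝ) 1) {g : ℝ → ℝ} (hg : Continuous g)
    (hg0 : ∀ x, 0 ≤ g x) {z : ℝ} (hz : 0 ≤ z)
    (hs : Summable fun n =>
      ∫ ω, pathWeight U θ g (fun _ => 1) 0 (hopCount U n ω) ω * z ^ n ∂μ)
    (i : Finset.Icc 1 R) (hi : (i : ℕ) = 1) (l : Finset.Icc 1 R) :
    Summable fun m => (weightMatrix R η g (fun l => z ^ l) ^ m) i l := by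
  have h1 := (h.summable_integral_norm_delayTerm hR hη hg hg0 hz hs).prod_symm.prod
  have hB : ∀ m i l, 0 ≤ (weightMatrix R η g (fun l => z ^ l) ^ m) i l :=
    pow_apply_nonneg (weightMatrix_nonneg hg0 fun l => pow_nonneg hz l)
  refine (summable_nat_add_iff 1).1 (Summable.of_nonneg_of_le (fun m => hB _ _ _) (fun m => ?_)
    ((summable_nat_add_iff 1).2 h1))
  exact (Finset.single_le_sum (f := fun l => (weightMatrix R η g (fun l => z ^ l) ^ (m + 1)) i l)
    (fun l _ => hB _ _ _) (Finset.mem_univ l)).trans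
    (h.sum_pow_le_tsum_delayTerm_succ hR hη hg hg0 hz i hi m)

theorem summable_weightMatrix_pow_diag [IsProbabilityMeasure μ] (h : IsTrickleProcess R η μ U θ)
    (hR : 1 ≤ R) (hη : η ∈ Set.Icc (0 : ℝ) 1) {g : ℝ → ℝ} (hg : Continuous g)
    (hg0 : ∀ x, 0 < g x) {z : ℝ} (hz : 0 ≤ z)
    (hs : Summable fun n =>
      ∫ ω, pathWeight U θ g (fun _ => 1) 0 (hopCount U n ω) ω * z ^ n ∂μ)
    (j : Finset.Icc 1 R) :
    Summable fun m => (weightMatrix R η g (fun l => z ^ l) ^ m) j j := by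
  set B := weightMatrix R η g (fun l => z ^ l) with hBdef
  have hB : ∀ i l, 0 ≤ B i l := weightMatrix_nonneg (fun x => (hg0 x).le) fun l => pow_nonneg hz l
  rcases hz.eq_or_lt with hz0 | hz0
  -- At z = 0 the two-step path below would have weight 0; instead all state weights 0 ^ l vanish,
  -- since l ≥ 1.
  · have hB0 : B = 0 := by
      ext i l
      have hl : (l : ℕ) ≠ 0 := by have := (Finset.mem_Icc.1 l.2).1; omega
      simp [hBdef, weightMatrix, ← hz0, hl]
    rw [hB0]
    exact (summable_nat_add_iff 1).1 (by simp)
  · let i : Finset.Icc 1 R := ⟨1, Finset.mem_Icc.2 ⟨le_rfl, hR⟩⟩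
    let r : Finset.Icc 1 R := ⟨R, Finset.mem_Icc.2 ⟨hR, le_rfl⟩⟩
    have hR0 : (0 : ℝ) < (R : ℝ)⁻¹ := inv_pos.2 (by exact_mod_cast hR)
    have hpos : ∀ i l : Finset.Icc 1 R, 0 < (stepProb R i l).toReal → 0 < B i l := by
      intro i l hil
      have hi := (Finset.mem_Icc.1 i.2).1
      have := isProbabilityMeasure_sojournLaw η hi
      have h1 : 0 < ∫ x, g x ∂sojournLaw η i := by
        rw [integral_pos_iff_support_of_nonneg (fun x => (hg0 x).le)
          (integrable_sojournLaw hη hi hg)]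
        have h2 : Function.support g = Set.univ := Set.eq_univ_of_forall fun x => (hg0 x).ne'
        rw [h2, measure_univ]
        exact one_pos
      exact mul_pos (mul_pos hil h1) (pow_pos hz0 _)
    -- The path 1 → R → j has positive weight, so `j` is reached in exactly two steps, and
    -- summability from state 1 passes to the diagonal.
    refine summable_pow_diag hB (h.summable_weightMatrix_pow hR hη hg (fun x => (hg0 x).le) hz hs
      i rfl j) (k := 2) ?_
    rw [pow_two, Matrix.mul_apply]
    refine lt_of_lt_of_le (mul_pos (hpos i r ?_) (hpos r j ?_))
      (Finset.single_le_sum (f := fun l => B i l * B l j)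
        (fun l _ => mul_nonneg (hB i l) (hB l j)) (Finset.mem_univ r))
    · exact hR0.trans_le (inv_le_stepProb_toReal_of_right i.2)
    · exact hR0.trans_le (stepProb_toReal_of_left j.2).ge

theorem summable_integral_delayTerm [IsProbabilityMeasure μ] (h : IsTrickleProcess R η μ U θ)
    (hR : 1 ≤ R) (hη : η ∈ Set.Icc (0 : ℝ) 1) {g : ℝ → 𝕜} (hg : Continuous g) (z : 𝕜)
    (hs : Summable fun n =>
      ∫ ω, pathWeight U θ (fun x => ‖g x‖) (fun _ => 1) 0 (hopCount U n ω) ω * ‖z‖ ^ n ∂μ) :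
    Summable fun p : ℕ × ℕ => ∫ ω, delayTerm U θ g z p.1 p.2 ω ∂μ := by
  have h1 := h.summable_integral_norm_delayTerm hR hη hg.norm (fun x => norm_nonneg _)
    (norm_nonneg z) hs
  refine Summable.of_norm_bounded h1 fun p => ?_
  refine (norm_integral_le_integral_norm _).trans_eq ?_
  simp_rw [norm_delayTerm]

theorem norm_weightMatrix_pow_le (R : ℕ) (η : ℝ) (g : ℝ → 𝕜) (z : 𝕜) (i l : Finset.Icc 1 R) :
    ‖weightMatrix R η g (fun l => z ^ l) i l‖ ≤
      weightMatrix R η (fun x => ‖g x‖) (fun l => ‖z‖ ^ l) i l := by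
  simpa only [norm_pow] using norm_weightMatrix_le R η g (fun l => z ^ l) i l

/-- Fubini for the absolutely convergent double series; the isolated 1 is hop count 0, which occurs
only for n = 0. -/
theorem tsum_delay_eq [IsProbabilityMeasure μ] (h : IsTrickleProcess R η μ U θ)
    (hR : 1 ≤ R) (hη : η ∈ Set.Icc (0 : ℝ) 1) {g : ℝ → 𝕜} (hg : Continuous g) (z : 𝕜)
    (hs : Summable fun n =>
      ∫ ω, pathWeight U θ (fun x => ‖g x‖) (fun _ => 1) 0 (hopCount U n ω) ω * ‖z‖ ^ n ∂μ) :
    ∑' n, ∫ ω, pathWeight U θ g (fun _ => 1) 0 (hopCount U n ω) ω * z ^ n ∂μ =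
      1 + ∑' m, ∑' n, ∫ ω, delayTerm U θ g z n (m + 1) ω ∂μ := by
  have hd := h.summable_integral_delayTerm hR hη hg z hs
  have h1 : ∀ n, ∫ ω, pathWeight U θ g (fun _ => 1) 0 (hopCount U n ω) ω * z ^ n ∂μ =
      ∑' m, ∫ ω, delayTerm U θ g z n m ω ∂μ := fun n =>
    (h.integrable_and_hasSum_delayTerm hR hη hg z n).2.tsum_eq.symm
  rw [tsum_congr h1,
    Summable.tsum_comm (f := fun m n => ∫ ω, delayTerm U θ g z n m ω ∂μ) hd.prod_symm]
  have h2 : Summable fun m => ∑' n, ∫ ω, delayTerm U θ g z n m ω ∂μ := hd.prod_symm.prod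
  rw [h2.tsum_eq_zero_add, (hasSum_integral_delayTerm_zero g z).tsum_eq]

theorem one_sub_mul_tsum_delay [IsProbabilityMeasure μ] (h : IsTrickleProcess R η μ U θ)
    (hR : 1 ≤ R) (hη : η ∈ Set.Icc (0 : ℝ) 1) {g : ℝ → 𝕜} (hg : Continuous g) (z : 𝕜)
    (hs : Summable fun n =>
      ∫ ω, pathWeight U θ (fun x => ‖g x‖) (fun _ => 1) 0 (hopCount U n ω) ω * ‖z‖ ^ n ∂μ)
    (i : Finset.Icc 1 R) (hi : (i : ℕ) = 1) :
    (1 - z) * (∑' n, ∫ ω, pathWeight U θ g (fun _ => 1) 0 (hopCount U n ω) ω * z ^ n ∂μ - 1) =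
      z * (∫ x, g x ∂sojournLaw η 1 + ∑ l : Finset.Icc 1 R,
        (∑' m, (weightMatrix R η g (fun l => z ^ l) ^ (m + 1)) i l) *
          (∫ x, g x ∂sojournLaw η l - 1)) := by
  rw [h.tsum_delay_eq hR hη hg z hs, add_sub_cancel_left, ← tsum_mul_left,
    tsum_congr fun m => h.one_sub_mul_tsum_delayTerm_succ hR hη hg z i hi m, tsum_mul_left]
  have hB := h.summable_weightMatrix_pow hR hη hg.norm (fun x => norm_nonneg _) (norm_nonneg z)
    hs i hi
  have hle := norm_weightMatrix_pow_le R η g z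
  have hK := fun l => Summable.of_norm_bounded (hB l) fun m => norm_pow_apply_le hle m i l
  have h1 := tsum_pow_mul_sub_pow_succ hK fun l : Finset.Icc 1 R => ∫ x, g x ∂sojournLaw η l
  rw [h1, hi]

theorem ae_passage_eq (h : IsTrickleProcess R η μ U θ) (hη : η ∈ Set.Icc (0 : ℝ) 1) (z s : ℂ)
    (i j : ℕ) :
    ∀ᵐ ω ∂μ, pathWeight U θ (fun x : ℝ => Complex.exp (s * x)) (fun l => z ^ l)
        (firstEntry U i ω) (passageSteps U i j ω) ω =
      z ^ passageNodes U θ i j ω * Complex.exp (s * passageTime U θ i j ω) := by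
  filter_upwards [h.ae_time_mem hη] with ω hω
  have h1 := updatedNodesAt_transmissionTime (U := U) fun m => (hω m).1
  rw [pathWeight_pow_exp, passageNodes, h1, h1]
  rfl

theorem integrable_cexp_endToEndDelay [IsProbabilityMeasure μ] (h : IsTrickleProcess R η μ U θ)
    (hR : 1 ≤ R) (hη : η ∈ Set.Icc (0 : ℝ) 1) (s : ℂ) (n : ℕ) :
    Integrable (fun ω => Complex.exp (s * endToEndDelay U θ n ω)) μ := by
  have h1 := (h.integrable_and_hasSum_delayTerm hR hη
    (g := fun x : ℝ => Complex.exp (s * x)) (by fun_prop) 1 n).1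
  simp only [one_pow, mul_one, pathWeight_cexp] at h1
  exact h1

/-- At most n hops, each of duration in (0, 1], give 0 ≤ T⁽ⁿ⁾ ≤ n. The maximum covers both signs of
σ. -/
theorem mgf_endToEndDelay_le [IsProbabilityMeasure μ] (h : IsTrickleProcess R η μ U θ)
    (hR : 1 ≤ R) (hη : η ∈ Set.Icc (0 : ℝ) 1) (σ : ℝ) (n : ℕ) :
    mgf (endToEndDelay U θ n) μ σ ≤ max 1 (Real.exp σ) ^ n := by
  have h1 : ∀ᵐ ω ∂μ, Real.exp (σ * endToEndDelay U θ n ω) ≤ max 1 (Real.exp σ) ^ n := by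
    filter_upwards [h.ae_state_mem hR, h.ae_time_mem hη] with ω hU hθ
    have h2 := transmissionTime_mem_Icc hθ (hopCount U n ω)
    have h3 : (hopCount U n ω : ℝ) ≤ n := by
      exact_mod_cast hopCount_le (fun m => (Finset.mem_Icc.1 (hU m)).1) n
    have h4 : endToEndDelay U θ n ω ∈ Set.Icc (0 : ℝ) n := ⟨h2.1, h2.2.trans h3⟩
    rcases le_total σ 0 with hσ | hσ
    · exact (Real.exp_le_one_iff.2 (mul_nonpos_of_nonpos_of_nonneg hσ h4.1)).trans
        (one_le_pow₀ (le_max_left _ _))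
    · refine le_trans ?_ (pow_le_pow_left₀ (Real.exp_pos σ).le (le_max_right _ _) n)
      rw [← Real.exp_nat_mul, mul_comm (n : ℝ)]
      exact Real.exp_le_exp.2 (mul_le_mul_of_nonneg_left h4.2 hσ)
  have h5 := integral_mono_of_nonneg (.of_forall fun ω => (Real.exp_pos _).le)
    (integrable_const _) h1
  simpa [mgf] using h5

/-- The closed form of the delay transform, wherever it converges absolutely. -/
theorem delayTransform_eq [IsProbabilityMeasure μ] (hproc : IsTrickleProcess R η μ U θ)
    (hR : 1 ≤ R) (hη : η ∈ Set.Icc (0 : ℝ) 1) (s : ℂ) {z : ℂ} (hz : z ≠ 1)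
    (hsum : Summable fun n : ℕ => mgf (endToEndDelay U θ n) μ s.re * ‖z‖ ^ n) :
    (∀ j ∈ Finset.Icc 1 R,
      Integrable (fun ω => z ^ passageNodes U θ 1 j ω *
        Complex.exp (s * passageTime U θ 1 j ω)) μ ∧
      Integrable (fun ω => z ^ passageNodes U θ j j ω *
        Complex.exp (s * passageTime U θ j j ω)) μ ∧
      passageTransform μ U θ j j z s ≠ 1) ∧
    HasSum (fun n : ℕ => complexMGF (endToEndDelay U θ n) μ s * z ^ n)
      (delayTransform μ U θ z s) ∧
    delayTransform μ U θ z s =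
      z / (z - 1) *
        (1 - sojournMGF η 1 s +
          ∑ j ∈ Finset.Icc 1 R, (1 - sojournMGF η j s) *
            (passageTransform μ U θ 1 j z s / (1 - passageTransform μ U θ j j z s))) +
        1 / (1 - z) := by
  have hcont : Continuous fun x : ℝ => Complex.exp (s * x) := by fun_prop
  have hnorm : (fun x : ℝ => ‖Complex.exp (s * x)‖) = fun x => Real.exp (s.re * x) :=
    funext (norm_cexp_mul s)
  have hs : Summable fun n => ∫ ω, pathWeight U θ (fun x : ℝ => ‖Complex.exp (s * x)‖)
      (fun _ => 1) 0 (hopCount U n ω) ω * ‖z‖ ^ n ∂μ := by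
    simp_rw [hnorm, pathWeight_exp, integral_mul_const]
    exact hsum
  set K := weightMatrix R η (fun x : ℝ => Complex.exp (s * x)) (fun l => z ^ l)
  set B := weightMatrix R η (fun x : ℝ => ‖Complex.exp (s * x)‖) (fun l => ‖z‖ ^ l)
  have hKB : ∀ i l, ‖K i l‖ ≤ B i l := norm_weightMatrix_pow_le R η _ z
  let one : Finset.Icc 1 R := ⟨1, Finset.mem_Icc.2 ⟨le_rfl, hR⟩⟩
  have hB1 : ∀ l, Summable fun m => (B ^ m) one l :=
    hproc.summable_weightMatrix_pow hR hη hcont.norm (fun _ => norm_nonneg _) (norm_nonneg z) hs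
      one rfl
  have hBd : ∀ l, Summable fun m => (B ^ m) l l :=
    hproc.summable_weightMatrix_pow_diag hR hη hcont.norm
      (fun _ => norm_pos_iff.2 (Complex.exp_ne_zero _)) (norm_nonneg z) hs
  have hpass : ∀ i j : Finset.Icc 1 R, (Summable fun m => (B ^ m) i j) →
      Integrable (fun ω => z ^ passageNodes U θ i j ω *
        Complex.exp (s * passageTime U θ i j ω)) μ ∧
      passageTransform μ U θ i j z s = ∑' k, firstPassage K i j k := by
    intro i j hij
    have h1 := hproc.integrable_and_integral_passage hR hη hcont (fun l => z ^ l) i j (by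
      simp only [norm_pow]
      have hBB : ∀ i l, ‖B i l‖ ≤ B i l := fun i l =>
        (Real.norm_of_nonneg ((norm_nonneg _).trans (hKB i l))).le
      exact Summable.of_norm_bounded ((summable_nat_add_iff 1).2 hij)
        (norm_firstPassage_le hBB i j))
    have h2 := hproc.ae_passage_eq hη z s i j
    exact ⟨h1.1.congr h2, (integral_congr_ae h2).symm.trans h1.2⟩
  -- With the passage transforms identified as first-passage sums of `K`, the renewal equation gives
  -- both the nonvanishing denominator and the quotient.
  have hren : ∀ j : Finset.Icc 1 R, passageTransform μ U θ j j z s ≠ 1 ∧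
      ∑' m, (K ^ (m + 1)) one j = passageTransform μ U θ 1 j z s /
        (1 - passageTransform μ U θ j j z s) := by
    intro j
    rw [(hpass j j (hBd j)).2, show passageTransform μ U θ 1 j z s = _ from
      (hpass one j (hB1 j)).2]
    exact tsum_pow_succ_eq_div hKB (hB1 j) (hBd j)
  refine ⟨fun j hj => ⟨(hpass one ⟨j, hj⟩ (hB1 _)).1, (hpass ⟨j, hj⟩ ⟨j, hj⟩ (hBd _)).1,
    (hren ⟨j, hj⟩).1⟩, ?_, ?_⟩
  · refine (Summable.of_norm_bounded hsum fun n => ?_).hasSum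
    rw [norm_mul, norm_pow]
    exact mul_le_mul_of_nonneg_right (norm_complexMGF_endToEndDelay_le μ U θ s n)
      (by positivity)
  · have h1 := hproc.one_sub_mul_tsum_delay hR hη hcont z hs one rfl
    have h2 : ∑' n, ∫ ω, pathWeight U θ (fun x : ℝ => Complex.exp (s * x)) (fun _ => 1) 0
        (hopCount U n ω) ω * z ^ n ∂μ = delayTransform μ U θ z s := by
      simp_rw [pathWeight_cexp, integral_mul_const]
      rfl
    have h3 : ∑ j ∈ Finset.Icc 1 R, (1 - sojournMGF η j s) *
          (passageTransform μ U θ 1 j z s / (1 - passageTransform μ U θ j j z s)) =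
        -∑ l : Finset.Icc 1 R, (∑' m, (K ^ (m + 1)) one l) *
          (∫ x : ℝ, Complex.exp (s * x) ∂sojournLaw η l - 1) := by
      rw [← Finset.sum_coe_sort, ← Finset.sum_neg_distrib]
      refine Finset.sum_congr rfl fun l _ => ?_
      rw [← (hren l).2]
      simp only [sojournMGF, complexMGF, id]
      ring
    have h4 : ∫ x : ℝ, Complex.exp (s * x) ∂sojournLaw η 1 = sojournMGF η 1 s := rfl
    rw [h2, h4] at h1
    have h5 : 1 - z ≠ 0 := sub_ne_zero.2 hz.symm
    have h6 : z - 1 ≠ 0 := sub_ne_zero.2 hz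
    rw [h3]
    generalize ∑ l : Finset.Icc 1 R, (∑' m, (K ^ (m + 1)) one l) *
      (∫ x : ℝ, Complex.exp (s * x) ∂sojournLaw η l - 1) = S at h1 ⊢
    have h7 : (1 - z) * (z / (z - 1)) = -z := by
      rw [← neg_sub z 1, neg_mul, mul_div_cancel₀ z h6]
    have h8 : (1 - z) * (1 / (1 - z)) = 1 := mul_div_cancel₀ 1 h5
    refine mul_left_cancel₀ h5 ?_
    linear_combination h1 - (1 - sojournMGF η 1 s + -S) * h7 - h8

end IsTrickleProcess

end Trickle

theorem mainTheorem7 (R : ℕ) (hR : 1 ≤ R) (η : ℝ) (hη : η ∈ Set.Icc (0 : ℝ) 1)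
    {Ω : Type*} [MeasurableSpace Ω] (μ : Measure Ω) [IsProbabilityMeasure μ]
    (U : ℕ → Ω → ℕ) (θ : ℕ → Ω → ℝ) (hproc : Trickle.IsTrickleProcess R η μ U θ) (s : ℂ) :
    -- all moment generating functions that occur are finite
    (∀ n : ℕ, Integrable (fun ω => Complex.exp (s * Trickle.endToEndDelay U θ n ω)) μ) ∧
    (∀ j ∈ Finset.Icc 1 R,
      Integrable (fun x : ℝ => Complex.exp (s * x)) (Trickle.sojournLaw η j)) ∧
    -- an explicit region in which the series converges absolutely
    (∀ z : ℂ, ‖z‖ < 1 → ‖z‖ * Real.exp s.re < 1 →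
      Summable fun n : ℕ => mgf (Trickle.endToEndDelay U θ n) μ s.re * ‖z‖ ^ n) ∧
    -- the closed form, wherever the series converges absolutely
    (∀ z : ℂ, z ≠ 1 →
      (Summable fun n : ℕ => mgf (Trickle.endToEndDelay U θ n) μ s.re * ‖z‖ ^ n) →
      (∀ j ∈ Finset.Icc 1 R,
        Integrable (fun ω => z ^ Trickle.passageNodes U θ 1 j ω *
          Complex.exp (s * Trickle.passageTime U θ 1 j ω)) μ ∧
        Integrable (fun ω => z ^ Trickle.passageNodes U θ j j ω *
          Complex.exp (s * Trickle.passageTime U θ j j ω)) μ ∧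
        Trickle.passageTransform μ U θ j j z s ≠ 1) ∧
      HasSum (fun n : ℕ => complexMGF (Trickle.endToEndDelay U θ n) μ s * z ^ n)
        (Trickle.delayTransform μ U θ z s) ∧
      Trickle.delayTransform μ U θ z s =
        z / (z - 1) *
          (1 - Trickle.sojournMGF η 1 s +
            ∑ j ∈ Finset.Icc 1 R, (1 - Trickle.sojournMGF η j s) *
              (Trickle.passageTransform μ U θ 1 j z s /
                (1 - Trickle.passageTransform μ U θ j j z s))) +
          1 / (1 - z)) ∧
    -- recovering the individual moment generating functions
    (∀ n : ℕ, complexMGF (Trickle.endToEndDelay U θ n) μ s =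
      1 / (n.factorial : ℂ) * iteratedDeriv n (fun z => Trickle.delayTransform μ U θ z s) 0) := by
  have hcont : Continuous fun x : ℝ => Complex.exp (s * x) := by fun_prop
  have hbound := hproc.mgf_endToEndDelay_le hR hη s.re
  have hM : 0 < max 1 (Real.exp s.re) := lt_max_of_lt_left one_pos
  refine ⟨hproc.integrable_cexp_endToEndDelay hR hη s,
    fun j hj => Trickle.integrable_sojournLaw hη (Finset.mem_Icc.1 hj).1 hcont, ?_, ?_, fun n =>
      Trickle.coeff_eq_iteratedDeriv_tsum hM (fun n =>
        (Trickle.norm_complexMGF_endToEndDelay_le μ U θ s n).trans (hbound n)) n⟩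
  · intro z hz1 hz2
    -- The two conditions on z together say that the geometric majorant has ratio below 1.
    have h1 : max 1 (Real.exp s.re) * ‖z‖ < 1 := by
      rw [max_mul_of_nonneg _ _ (norm_nonneg z)]
      exact max_lt (by simpa using hz1) (by rwa [mul_comm])
    refine Summable.of_nonneg_of_le (fun n => mul_nonneg mgf_nonneg (by positivity))
      (fun n => ?_) (summable_geometric_of_lt_one (by positivity) h1)
    rw [mul_pow]
    exact mul_le_mul_of_nonneg_right (hbound n) (by positivity)
  · exact fun z hz hsum => hproc.delayTransform_eq hR hη s hz hsum
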